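/- Let $\mathcal{A}_1,\mathcal{A}_2$ be finite non-empty action sets. A game is a pair $G=(U_1,U_2)$ of utility functions $U_i(\cdot,\cdot;G):\mathcal{A}_1\times\mathcal{A}_2\to\mathbb{R}$, extended bilinearly to mixed strategies. Let $\mathcal{G}$ be any family of games and $\mathcal{D}$ a (discrete) probability distribution on $\mathcal{G}$ with $\mathbb{E}_{G\sim\mathcal{D}}|U_i(a,b;G)|<\infty$ for all $i,a,b$ (automatic if $\mathcal{G}$ is finite). An action $a_0\in\mathcal{A}_1$ is weakly dominated in $G$ if some $\mathbf{x}\in\Delta(\mathcal{A}_1\setminus\{a_0\})$ satisfies $U_1(\mathbf{x},b;G)\ge U_1(a_0,b;G)$ for every $b\in\mathcal{A}_2$; symmetrically for $\mathrm{P}_2$. Assume that in every game in the support of $\mathcal{D}$ neither player has a weakly dominated action. Let $$\mathrm{StackVal}_1(G)=\max_{\mathbf{x}\in\Delta(\mathcal{A}_1)}\ \max_{b\in \mathrm{BR}_2(\mathbf{x};G)}U_1(\mathbf{x},b;G),\qquad \mathrm{BR}_2(\mathbf{x};G)=\arg\max_{b\in\mathcal{A}_2}U_2(\mathbf{x},b;G).$$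 A game $G\sim\mathcal{D}$ is drawn once and then repeated. Given $G$, the players receive independent signals $s_1,s_2\in\mathcal{G}$; $s_i$ equals $G$ with probability $p_i$ and is a fresh draw from $\mathcal{D}$ otherwise. Here $p_1=1$ ($\mathrm{P}_1$ is fully informed) and $p_2\in[0,1]$ is arbitrary. An algorithm $\pi_i$ of $\mathrm{P}_i$ is a sequence of (measurable) maps, one for each round $t=1,2,\dots$, from $s_i$ and $\mathrm{P}_i$'s feedback in rounds $1,\dots,t-1$ to a probability distribution on mixed strategies, from which the strategy of round $t$ (that is, $\mathbf{x}^t\in\Delta(\mathcal{A}_1)$ for $\mathrm{P}_1$ and $\mathbf{y}^t\in\Delta(\mathcal{A}_2)$ for $\mathrm{P}_2$) is drawn; the players draw independently of each other given the past. The feedback of $\mathrm{P}_i$ in round $r$ is $(\mathbf{x}^r,\mathbf{y}^r,U_i(\mathbf{x}^r,\mathbf{y}^r;G))$ under full-information feedback, and only her own strategy of round $r$ together with $U_i(\mathbf{x}^r,\mathbf{y}^r;G)$ under bandit feedback. Let $\bar U_i^T(\pi_1,\pi_2;G)$ be the expectation, given $G$, of $\frac1T\sum_{t=1}^T U_i(\mathbf{x}^t,\mathbf{y}^t;G)$,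 and $\bar U_i^T(\pi_1,\pi_2;\mathcal{D})=\mathbb{E}_{G\sim\mathcal{D}}\,\bar U_i^T(\pi_1,\pi_2;G)$. The pair $(\pi_1,\pi_2)$ is a pure Nash equilibrium (PNE) of the meta-game if for each $i\in\{1,2\}$ and every algorithm $\pi_i'$ of $\mathrm{P}_i$ $$\limsup_{T\to\infty}\Big(\bar U_i^T(\pi_i',\pi_{-i};\mathcal{D})-\bar U_i^T(\pi_i,\pi_{-i};\mathcal{D})\Big)\le 0 .$$ **Theorem 1.** Under either feedback model there is a pair of algorithms $(\pi_1,\pi_2)$ that is a PNE of the meta-game and such that, for every $G\in\mathcal{G}$ in which no action of either player is weakly dominated (in particular for every $G$ in the support of $\mathcal{D}$), $$\bar U_1^T(\pi_1,\pi_2;G)\ \ge\ \mathrm{StackVal}_1(G)-o_T(1),$$ and in fact $\bar U_1^T(\pi_1,\pi_2;G)\to \mathrm{StackVal}_1(G)$ as $T\to\infty$. -/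

import Mathlib

open MeasureTheory ProbabilityTheory Filter Topology

noncomputable section

namespace RepeatedBayesianGame

/-- Mixed strategies over a finite action set, with the measurable structure inherited
from `A → ℝ`. -/
abbrev Mixed (A : Type*) [Fintype A] : Type _ := ↥(stdSimplex ℝ A)

/-- A two-player stage game: the utility functions of the two players. -/
structure Game (A₁ A₂ : Type*) where
  U₁ : A₁ → A₂ → ℝ
  U₂ : A₁ → A₂ → ℝ

namespace Game

variable {A₁ A₂ : Type*} [Fintype A₁] [Fintype A₂]

/-- Expected utility of the first player under a pair of mixed strategies. -/
def eu₁ (G : Game A₁ A₂) (x : Mixed A₁) (y : Mixed A₂) : ℝ :=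
  ∑ a, ∑ b, x.1 a * y.1 b * G.U₁ a b

/-- Expected utility of the second player under a pair of mixed strategies. -/
def eu₂ (G : Game A₁ A₂) (x : Mixed A₁) (y : Mixed A₂) : ℝ :=
  ∑ a, ∑ b, x.1 a * y.1 b * G.U₂ a b

/-- `a₀` is weakly dominated for the first player: some mixture of the other actions does at
least as well against every action of the opponent. -/
def WeaklyDominated₁ (G : Game A₁ A₂) (a₀ : A₁) : Prop :=
  ∃ x : Mixed A₁, x.1 a₀ = 0 ∧ ∀ b, G.U₁ a₀ b ≤ ∑ a, x.1 a * G.U₁ a b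

/-- `b₀` is weakly dominated for the second player. -/
def WeaklyDominated₂ (G : Game A₁ A₂) (b₀ : A₂) : Prop :=
  ∃ y : Mixed A₂, y.1 b₀ = 0 ∧ ∀ a, G.U₂ a b₀ ≤ ∑ b, y.1 b * G.U₂ a b

/-- Neither player has a weakly dominated action. -/
def NoWeaklyDominatedAction (G : Game A₁ A₂) : Prop :=
  (∀ a, ¬ G.WeaklyDominated₁ a) ∧ (∀ b, ¬ G.WeaklyDominated₂ b)

/-- The set of pure best responses of the second player to a mixed strategy of the first. -/
def bestResponse₂ (G : Game A₁ A₂) (x : Mixed A₁) : Set A₂ :=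
  {b | ∀ b', ∑ a, x.1 a * G.U₂ a b' ≤ ∑ a, x.1 a * G.U₂ a b}

/-- The optimistic Stackelberg value of the first player: the largest utility she can get by
committing to a mixed strategy, the second player best responding with ties broken in the
first player's favour. -/
def stackVal₁ (G : Game A₁ A₂) : ℝ :=
  sSup {v | ∃ x : Mixed A₁, ∃ b ∈ G.bestResponse₂ x, v = ∑ a, x.1 a * G.U₁ a b}

end Game

/-- The two feedback models: in each round a player observes both realized strategies and her
own realized utility (`full`), or only her own strategy and her own utility (`bandit`). -/
inductive Feedback where
  | full
  | bandit

/-- What a player sees of the strategy (in `S`) that her opponent played: the strategy itself,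
or nothing. -/
def Feedback.View : Feedback → Type* → Type _
  | .full, S => S
  | .bandit, _ => PUnit

instance (fb : Feedback) (S : Type*) [m : MeasurableSpace S] : MeasurableSpace (fb.View S) :=
  match fb with
  | .full => m
  | .bandit => ⊤

/-- The part of the opponent's realized strategy that is revealed. -/
def Feedback.view {S : Type*} : (fb : Feedback) → S → fb.View S
  | .full, s => s
  | .bandit, _ => PUnit.unit

/-- The feedback of one round for a player with strategy space `S` whose opponent has strategy
space `S'`: own strategy, what is revealed of the opponent's strategy, own utility. -/
abbrev Feedback.Observation (fb : Feedback) (S S' : Type*) : Type _ := S × fb.View S' × ℝ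

/-- An algorithm of a player with action set `A` against an opponent with action set `B`, where
signals lie in `I`: in round `t` (rounds are numbered from `0`) it maps the signal and the
feedback of the `t` earlier rounds, measurably in the latter, to a probability distribution on
mixed strategies. -/
structure Algorithm (fb : Feedback) (I A B : Type*) [Fintype A] [Fintype B] where
  kernel : I → (t : ℕ) → Kernel (Fin t → fb.Observation (Mixed A) (Mixed B)) (Mixed A)
  markov : ∀ s t, IsMarkovKernel (kernel s t)

section Interaction

variable {A₁ A₂ : Type*} [Fintype A₁] [Fintype A₂]

/-- A trajectory of `T` rounds: the pair of mixed strategies played in each round. -/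
abbrev Trajectory (A₁ A₂ : Type*) [Fintype A₁] [Fintype A₂] (T : ℕ) : Type _ :=
  Fin T → Mixed A₁ × Mixed A₂

/-- The feedback that the first player has received along a trajectory in the game `G`. -/
def history₁ (fb : Feedback) (G : Game A₁ A₂) {T : ℕ} (h : Trajectory A₁ A₂ T) :
    Fin T → fb.Observation (Mixed A₁) (Mixed A₂) :=
  fun r => ((h r).1, fb.view (h r).2, G.eu₁ (h r).1 (h r).2)

/-- The feedback that the second player has received along a trajectory in the game `G`. -/
def history₂ (fb : Feedback) (G : Game A₁ A₂) {T : ℕ} (h : Trajectory A₁ A₂ T) :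
    Fin T → fb.Observation (Mixed A₂) (Mixed A₁) :=
  fun r => ((h r).2, fb.view (h r).1, G.eu₂ (h r).1 (h r).2)

theorem Feedback.measurable_view (fb : Feedback) {S : Type*} [MeasurableSpace S] :
    Measurable (fb.view : S → fb.View S) := by
  cases fb with
  | full => exact measurable_id
  | bandit => exact measurable_const

theorem Game.measurable_eu₁ (G : Game A₁ A₂) :
    Measurable fun z : Mixed A₁ × Mixed A₂ => G.eu₁ z.1 z.2 := by
  unfold Game.eu₁
  refine Finset.measurable_sum _ fun a _ => Finset.measurable_sum _ fun b _ => ?_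
  exact (((measurable_pi_apply a).comp (measurable_subtype_coe.comp measurable_fst)).mul
    ((measurable_pi_apply b).comp (measurable_subtype_coe.comp measurable_snd))).mul_const _

theorem Game.measurable_eu₂ (G : Game A₁ A₂) :
    Measurable fun z : Mixed A₁ × Mixed A₂ => G.eu₂ z.1 z.2 := by
  unfold Game.eu₂
  refine Finset.measurable_sum _ fun a _ => Finset.measurable_sum _ fun b _ => ?_
  exact (((measurable_pi_apply a).comp (measurable_subtype_coe.comp measurable_fst)).mul
    ((measurable_pi_apply b).comp (measurable_subtype_coe.comp measurable_snd))).mul_const _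

theorem measurable_history₁ (fb : Feedback) (G : Game A₁ A₂) (T : ℕ) :
    Measurable (history₁ fb G : Trajectory A₁ A₂ T → _) := by
  refine measurable_pi_lambda _ fun r => ?_
  have hr : Measurable fun h : Trajectory A₁ A₂ T => h r := measurable_pi_apply r
  exact (measurable_fst.comp hr).prodMk
    ((fb.measurable_view.comp (measurable_snd.comp hr)).prodMk (G.measurable_eu₁.comp hr))

theorem measurable_history₂ (fb : Feedback) (G : Game A₁ A₂) (T : ℕ) :
    Measurable (history₂ fb G : Trajectory A₁ A₂ T → _) := by
  refine measurable_pi_lambda _ fun r => ?_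
  have hr : Measurable fun h : Trajectory A₁ A₂ T => h r := measurable_pi_apply r
  exact (measurable_snd.comp hr).prodMk
    ((fb.measurable_view.comp (measurable_fst.comp hr)).prodMk (G.measurable_eu₂.comp hr))

/-- The law of the pair of strategies played in round `T`, given the earlier rounds: the two
players draw their strategies independently, each from the distribution that her algorithm
prescribes for her own signal and feedback. -/
def roundKernel {fb : Feedback} {I : Type*} (π₁ : Algorithm fb I A₁ A₂)
    (π₂ : Algorithm fb I A₂ A₁) (G : Game A₁ A₂) (s₁ s₂ : I) (T : ℕ) :
    Kernel (Trajectory A₁ A₂ T) (Mixed A₁ × Mixed A₂) :=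
  ((π₁.kernel s₁ T).comap (history₁ fb G) (measurable_history₁ fb G T)) ×ₖ
    ((π₂.kernel s₂ T).comap (history₂ fb G) (measurable_history₂ fb G T))

/-- The law of the trajectory of the first `T` rounds when the realized game is `G` and the
signals are `s₁`, `s₂`. -/
def trajectoryLaw {fb : Feedback} {I : Type*} (π₁ : Algorithm fb I A₁ A₂)
    (π₂ : Algorithm fb I A₂ A₁) (G : Game A₁ A₂) (s₁ s₂ : I) :
    (T : ℕ) → Measure (Trajectory A₁ A₂ T)
  | 0 => Measure.dirac Fin.elim0
  | T + 1 => ((trajectoryLaw π₁ π₂ G s₁ s₂ T) ⊗ₘ (roundKernel π₁ π₂ G s₁ s₂ T)).map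
      fun z => Fin.snoc (α := fun _ => Mixed A₁ × Mixed A₂) z.1 z.2

/-- Expected utility of the first player, averaged over `T` rounds, for given signals. -/
def signalUtility₁ {fb : Feedback} {I : Type*} (π₁ : Algorithm fb I A₁ A₂)
    (π₂ : Algorithm fb I A₂ A₁) (G : Game A₁ A₂) (s₁ s₂ : I) (T : ℕ) : ℝ :=
  ∫ h, (1 / (T : ℝ)) * ∑ t, G.eu₁ (h t).1 (h t).2 ∂(trajectoryLaw π₁ π₂ G s₁ s₂ T)

/-- Expected utility of the second player, averaged over `T` rounds, for given signals. -/
def signalUtility₂ {fb : Feedback} {I : Type*} (π₁ : Algorithm fb I A₁ A₂)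
    (π₂ : Algorithm fb I A₂ A₁) (G : Game A₁ A₂) (s₁ s₂ : I) (T : ℕ) : ℝ :=
  ∫ h, (1 / (T : ℝ)) * ∑ t, G.eu₂ (h t).1 (h t).2 ∂(trajectoryLaw π₁ π₂ G s₁ s₂ T)

open Classical in
/-- The probability of the signal `s` of precision `p` when the realized game is `G`: the signal
equals `G` with probability `p`, and is an independent draw from the prior otherwise. -/
def signalProb {I : Type*} (D : PMF I) (p : ℝ) (G s : I) : ℝ :=
  p * (if s = G then 1 else 0) + (1 - p) * (D s).toReal

variable {𝒢 : Set (Game A₁ A₂)} {fb : Feedback}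

/-- The expected average utility of the first player over `T` rounds when the realized game is
`G`; the signals are conditionally independent, with precisions `p₁` and `p₂`. -/
def gameUtility₁ (D : PMF 𝒢) (p₁ p₂ : ℝ) (π₁ : Algorithm fb 𝒢 A₁ A₂)
    (π₂ : Algorithm fb 𝒢 A₂ A₁) (G : 𝒢) (T : ℕ) : ℝ :=
  ∑' s₁, ∑' s₂, signalProb D p₁ G s₁ * signalProb D p₂ G s₂ * signalUtility₁ π₁ π₂ G s₁ s₂ T

/-- The expected average utility of the second player over `T` rounds when the realized game
is `G`. -/
def gameUtility₂ (D : PMF 𝒢) (p₁ p₂ : ℝ) (π₁ : Algorithm fb 𝒢 A₁ A₂)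
    (π₂ : Algorithm fb 𝒢 A₂ A₁) (G : 𝒢) (T : ℕ) : ℝ :=
  ∑' s₁, ∑' s₂, signalProb D p₁ G s₁ * signalProb D p₂ G s₂ * signalUtility₂ π₁ π₂ G s₁ s₂ T

/-- The expected average utility of the first player over `T` rounds under the prior. -/
def priorUtility₁ (D : PMF 𝒢) (p₁ p₂ : ℝ) (π₁ : Algorithm fb 𝒢 A₁ A₂)
    (π₂ : Algorithm fb 𝒢 A₂ A₁) (T : ℕ) : ℝ :=
  ∑' G, (D G).toReal * gameUtility₁ D p₁ p₂ π₁ π₂ G T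

/-- The expected average utility of the second player over `T` rounds under the prior. -/
def priorUtility₂ (D : PMF 𝒢) (p₁ p₂ : ℝ) (π₁ : Algorithm fb 𝒢 A₁ A₂)
    (π₂ : Algorithm fb 𝒢 A₂ A₁) (T : ℕ) : ℝ :=
  ∑' G, (D G).toReal * gameUtility₂ D p₁ p₂ π₁ π₂ G T

/-- Pure Nash equilibrium of the meta-game whose actions are algorithms: no unilateral deviation
gives an asymptotically non-vanishing gain. The upper limits are taken in the extended reals. -/
def IsPureNashEquilibrium (D : PMF 𝒢) (p₁ p₂ : ℝ) (π₁ : Algorithm fb 𝒢 A₁ A₂)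
    (π₂ : Algorithm fb 𝒢 A₂ A₁) : Prop :=
  (∀ π₁' : Algorithm fb 𝒢 A₁ A₂,
    limsup (fun T : ℕ =>
      ((priorUtility₁ D p₁ p₂ π₁' π₂ T - priorUtility₁ D p₁ p₂ π₁ π₂ T : ℝ) : EReal)) atTop ≤ 0) ∧
  (∀ π₂' : Algorithm fb 𝒢 A₂ A₁,
    limsup (fun T : ℕ =>
      ((priorUtility₂ D p₁ p₂ π₁ π₂' T - priorUtility₂ D p₁ p₂ π₁ π₂ T : ℝ) : EReal)) atTop ≤ 0)

end Interaction

end RepeatedBayesianGame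

end

/-!
The second player can cap the first player at her Stackelberg value without knowing the game, by
learning without swap regret; the first player can attain that value by committing. These two
algorithms form the equilibrium.

The second player ignores her signal. She keeps a matrix `R` of estimated regrets, where `R b b'`
estimates the gain from having played `b'` whenever she played `b`, and plays (up to a vanishing
amount of uniform exploration) a stationary distribution of the Markov chain with jump rates
`(R b b')⁺`. She always plays a pure action, so that importance weighting turns her own utility
into an unbiased estimate of the utilities of all her actions, and bandit feedback suffices.
Stationarity makes the first-order change of `∑ ((R b b')⁺)²` vanish in expectation
(`sum_playProb_mul_regretPotential_le`), whence the regrets are `O(T ^ (3/4))` against every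
algorithm of the first player (`sum_occupation_mul_sub_le`). Hence the empirical joint distribution
of actions, in expectation, is asymptotically one in which every action of the second player is a
best response to the conditional strategy of the first. Such a distribution gives the first player
at most the Stackelberg value (`Game.sum_mul_le_stackVal₁`), and by compactness this bound passes
to the limit (`eventually_average_le_stackVal₁`).

The first player, who knows the game, commits to a sequence of mixed strategies that converges to
an optimal commitment `x₀` with favourable best response `b₀`. As `b₀` is not weakly dominated, it
is the unique best response to some mixed strategy (`Game.exists_unique_bestResponse₂`); mixing in
this strategy with weight `(t + 1) ^ (-1/8)` makes `b₀` the unique best response in every round, by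
a margin large compared with the average regret. So the learner plays `b₀` in all but a vanishing
fraction of the rounds, and both players' average payoffs converge to those of `(x₀, b₀)`
(`tendsto_average_commitAlgorithm`). For the first player this is the Stackelberg value. The second
player can gain nothing by deviating, since no algorithm of hers, whatever her signal, beats best
responding in each round, and the payoff of that has the same limit. The gains from deviating
vanish for each game in the support, hence on average, by dominated convergence
(`limsup_tsum_sub_tsum_le`).
-/

noncomputable section

namespace RepeatedBayesianGame

/-! ### Approximately stationary distributions -/

section Learner

variable {A : Type*} [Fintype A]

/-- The net flow of mass into the state `b` when mass distributed as `v` jumps from `c` to `c'`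
at rate `(R c c')⁺`. It vanishes at every `b` exactly when `v` is stationary. -/
def netFlow (R : A → A → ℝ) (v : A → ℝ) (b : A) : ℝ :=
  ∑ c, v c * max (R c b) 0 - v b * ∑ c, max (R b c) 0

/-- A normalization of the jump rates `(R c c')⁺` under which one unit of time is at most one
jump. -/
def flowScale (R : A → A → ℝ) : ℝ := 1 + ∑ b, ∑ c, max (R b c) 0

/-- One step of the Markov chain on `A` with transition probabilities `(R c c')⁺ / flowScale R`
for `c ≠ c'`. -/
def flowStep (R : A → A → ℝ) (v : A → ℝ) (b : A) : ℝ := v b + netFlow R v b / flowScale R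

/-- The distribution after `k` steps of the chain, started at the uniform distribution. -/
def flowIterate (R : A → A → ℝ) : ℕ → A → ℝ
  | 0 => fun _ => 1 / (Fintype.card A : ℝ)
  | k + 1 => flowStep R (flowIterate R k)

/-- The Cesàro average of the first `N` distributions of the chain. It is stationary up to an
error of order `1 / N`, and, unlike an exactly stationary distribution, it is given by an explicit
formula, which makes its measurability in `R` evident. -/
def almostStationary (N : ℕ) (R : A → A → ℝ) (b : A) : ℝ :=
  1 / (N : ℝ) * ∑ k ∈ Finset.range N, flowIterate R k b

theorem one_le_flowScale (R : A → A → ℝ) : 1 ≤ flowScale R := by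
  have : 0 ≤ ∑ b, ∑ c, max (R b c) 0 :=
    Finset.sum_nonneg fun b _ => Finset.sum_nonneg fun c _ => le_max_right _ _
  unfold flowScale; linarith

theorem sum_netFlow (R : A → A → ℝ) (v : A → ℝ) : ∑ b, netFlow R v b = 0 := by
  unfold netFlow
  rw [Finset.sum_sub_distrib, Finset.sum_comm]
  simp [Finset.mul_sum]

theorem flowStep_mem_stdSimplex (R : A → A → ℝ) {v : A → ℝ} (hv : v ∈ stdSimplex ℝ A) :
    flowStep R v ∈ stdSimplex ℝ A := by
  have hs := one_le_flowScale R
  refine ⟨fun b => ?_, ?_⟩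
  · have h1 : 0 ≤ ∑ c, v c * max (R c b) 0 :=
      Finset.sum_nonneg fun c _ => mul_nonneg (hv.1 c) (le_max_right _ _)
    have h2 : ∑ c, max (R b c) 0 ≤ flowScale R := by
      have := Finset.single_le_sum (f := fun b => ∑ c, max (R b c) 0)
        (fun b _ => Finset.sum_nonneg fun c _ => le_max_right _ _) (Finset.mem_univ b)
      unfold flowScale; linarith
    have h3 : v b * ∑ c, max (R b c) 0 ≤ v b * flowScale R :=
      mul_le_mul_of_nonneg_left h2 (hv.1 b)
    have : flowStep R v b = (v b * flowScale R + netFlow R v b) / flowScale R := by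
      unfold flowStep; field_simp
    rw [this]
    apply div_nonneg _ (by linarith)
    unfold netFlow; linarith
  · unfold flowStep
    rw [Finset.sum_add_distrib, ← Finset.sum_div, sum_netFlow, hv.2]; simp

variable [Nonempty A]

theorem flowIterate_mem_stdSimplex (R : A → A → ℝ) (k : ℕ) :
    flowIterate R k ∈ stdSimplex ℝ A := by
  induction k with
  | zero =>
    refine ⟨fun b => by simp [flowIterate], ?_⟩
    simp [flowIterate]
  | succ k ih => exact flowStep_mem_stdSimplex R ih

theorem almostStationary_mem_stdSimplex {N : ℕ} (hN : 0 < N) (R : A → A → ℝ) :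
    almostStationary N R ∈ stdSimplex ℝ A := by
  have hN' : (N : ℝ) ≠ 0 := by positivity
  refine ⟨fun b => mul_nonneg (by positivity)
    (Finset.sum_nonneg fun k _ => (flowIterate_mem_stdSimplex R k).1 b), ?_⟩
  unfold almostStationary
  rw [← Finset.mul_sum, Finset.sum_comm]
  simp [(flowIterate_mem_stdSimplex R _).2, hN']

theorem le_one_of_mem_stdSimplex {B : Type*} [Fintype B] {v : B → ℝ} (hv : v ∈ stdSimplex ℝ B)
    (b : B) : v b ≤ 1 := by
  rw [← hv.2]; exact Finset.single_le_sum (fun b _ => hv.1 b) (Finset.mem_univ b)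

theorem netFlow_almostStationary {A : Type*} [Fintype A] {N : ℕ} (R : A → A → ℝ) (b : A) :
    netFlow R (almostStationary N R) b =
      flowScale R / N * (flowIterate R N b - flowIterate R 0 b) := by
  have hs : flowScale R ≠ 0 := by have := one_le_flowScale R; positivity
  have h1 : netFlow R (almostStationary N R) b =
      1 / (N : ℝ) * ∑ k ∈ Finset.range N, netFlow R (flowIterate R k) b := by
    unfold netFlow almostStationary
    rw [Finset.sum_sub_distrib, ← Finset.sum_mul, Finset.sum_comm, mul_sub]
    congr 1
    · rw [Finset.mul_sum]
      refine Finset.sum_congr rfl fun c _ => ?_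
      rw [mul_assoc, Finset.sum_mul]
    · rw [mul_assoc]
  have h2 : ∀ k, netFlow R (flowIterate R k) b =
      flowScale R * (flowIterate R (k + 1) b - flowIterate R k b) := by
    intro k
    have : flowIterate R (k + 1) b =
      flowIterate R k b + netFlow R (flowIterate R k) b / flowScale R := rfl
    rw [this]; field_simp; ring
  rw [h1, Finset.sum_congr rfl fun k _ => h2 k, ← Finset.mul_sum,
    Finset.sum_range_sub (fun k => flowIterate R k b)]
  ring

theorem abs_netFlow_almostStationary_le {N : ℕ} (R : A → A → ℝ) (b : A) :
    |netFlow R (almostStationary N R) b| ≤ flowScale R / N := by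
  have hs := one_le_flowScale R
  rw [netFlow_almostStationary, abs_mul, abs_of_nonneg (by positivity)]
  have h1 := flowIterate_mem_stdSimplex R N
  have h0 := flowIterate_mem_stdSimplex R 0
  have : |flowIterate R N b - flowIterate R 0 b| ≤ 1 := by
    rw [abs_le]
    constructor <;> linarith [h1.1 b, h0.1 b, le_one_of_mem_stdSimplex h1 b,
      le_one_of_mem_stdSimplex h0 b]
  calc _ ≤ flowScale R / N * 1 := mul_le_mul_of_nonneg_left this (by positivity)
    _ = _ := mul_one _

/-! ### The learning rule of the second player -/

/-- The probability of uniform exploration in round `t`. -/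
def explorationRate (t : ℕ) : ℝ := ((t : ℝ) + 1) ^ (-(1 / 4) : ℝ)

/-- The distribution that the learner aims at in round `t`, when `R` is her matrix of estimated
cumulative regrets: `R b b'` estimates the gain from having played `b'` whenever she played `b`.
The number `(t + 1) ^ 2` of steps keeps the error of almost stationarity bounded, as `flowScale R`
is of order at most `t ^ 2`. -/
def targetDist (t : ℕ) (R : A → A → ℝ) : A → ℝ := almostStationary ((t + 1) ^ 2) R

/-- The probability with which the learner plays the pure action `b` in round `t`. -/
def playProb (t : ℕ) (R : A → A → ℝ) (b : A) : ℝ :=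
  (1 - explorationRate t) * targetDist t R b + explorationRate t / Fintype.card A

/-- The estimated regret of one round in which the strategy `y` yielded the utility `u`. Here
`y c * u / playProb t R c` is the importance-weighted estimate of the utility of the action `c`:
it is unbiased if `y` is the pure action `c` with probability `playProb t R c`. -/
def regretIncrement (t : ℕ) (R : A → A → ℝ) (y : Mixed A) (u : ℝ) (b b' : A) : ℝ :=
  targetDist t R b * (y.1 b' * u / playProb t R b' - y.1 b * u / playProb t R b)

open Classical in
/-- A pure action as a mixed strategy. -/
def pureStrategy {A : Type*} [Fintype A] (b : A) : Mixed A :=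
  ⟨Pi.single b 1, single_mem_stdSimplex ℝ b⟩

/-- The squared norm of the positive part of the regret matrix. -/
def regretPotential (R : A → A → ℝ) : ℝ := ∑ b, ∑ c, (max (R b c) 0) ^ 2

theorem sum_pureStrategy_mul {A : Type*} [Fintype A] (b : A) (f : A → ℝ) :
    ∑ c, (pureStrategy b).1 c * f c = f b := by
  classical
  simp [pureStrategy, Pi.single_apply]

theorem sum_mul_pureStrategy {A : Type*} [Fintype A] (c : A) (f : A → ℝ) :
    ∑ b, f b * (pureStrategy b).1 c = f c := by
  classical
  simp [pureStrategy, Pi.single_apply]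

theorem explorationRate_pos (t : ℕ) : 0 < explorationRate t := by
  unfold explorationRate; positivity

theorem explorationRate_le_one (t : ℕ) : explorationRate t ≤ 1 :=
  Real.rpow_le_one_of_one_le_of_nonpos (by linarith [Nat.cast_nonneg (α := ℝ) t]) (by norm_num)

theorem inv_explorationRate_le (t : ℕ) : 1 / explorationRate t ≤ (t : ℝ) + 1 := by
  have h : (1 : ℝ) ≤ t + 1 := by linarith [Nat.cast_nonneg (α := ℝ) t]
  unfold explorationRate
  rw [Real.rpow_neg (by linarith), one_div, inv_inv]
  calc ((t : ℝ) + 1) ^ (1 / 4 : ℝ) ≤ ((t : ℝ) + 1) ^ (1 : ℝ) :=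
        Real.rpow_le_rpow_of_exponent_le h (by norm_num)
    _ = _ := Real.rpow_one _

theorem inv_explorationRate_sq (t : ℕ) :
    (1 / explorationRate t) ^ 2 = ((t : ℝ) + 1) ^ (1 / 2 : ℝ) := by
  have h : (0 : ℝ) ≤ t + 1 := by positivity
  unfold explorationRate
  rw [Real.rpow_neg h, one_div, inv_inv, ← Real.rpow_natCast, ← Real.rpow_mul h]
  norm_num

theorem targetDist_mem_stdSimplex (t : ℕ) (R : A → A → ℝ) :
    targetDist t R ∈ stdSimplex ℝ A := almostStationary_mem_stdSimplex (by positivity) R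

theorem explorationRate_div_card_le_playProb (t : ℕ) (R : A → A → ℝ) (b : A) :
    explorationRate t / Fintype.card A ≤ playProb t R b := by
  have := mul_nonneg (sub_nonneg.2 (explorationRate_le_one t)) ((targetDist_mem_stdSimplex t R).1 b)
  unfold playProb; linarith

theorem playProb_pos (t : ℕ) (R : A → A → ℝ) (b : A) : 0 < playProb t R b :=
  lt_of_lt_of_le (div_pos (explorationRate_pos t) (by exact_mod_cast Fintype.card_pos))
    (explorationRate_div_card_le_playProb t R b)

theorem sum_playProb (t : ℕ) (R : A → A → ℝ) : ∑ b, playProb t R b = 1 := by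
  have hn : (Fintype.card A : ℝ) ≠ 0 := by exact_mod_cast Fintype.card_ne_zero
  unfold playProb
  rw [Finset.sum_add_distrib, ← Finset.mul_sum, (targetDist_mem_stdSimplex t R).2]
  simp; field_simp; ring

theorem abs_playProb_sub_targetDist_le (t : ℕ) (R : A → A → ℝ) (b : A) :
    |playProb t R b - targetDist t R b| ≤ explorationRate t := by
  have hn : (1 : ℝ) ≤ Fintype.card A := by exact_mod_cast Fintype.card_pos
  have h1 := (targetDist_mem_stdSimplex t R).1 b
  have h2 := le_one_of_mem_stdSimplex (targetDist_mem_stdSimplex t R) b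
  have hg := explorationRate_pos t
  have : playProb t R b - targetDist t R b =
    explorationRate t * (1 / Fintype.card A - targetDist t R b) := by unfold playProb; ring
  rw [this, abs_mul, abs_of_pos hg]
  refine mul_le_of_le_one_right hg.le (abs_le.2 ⟨?_, ?_⟩)
  · have : (0 : ℝ) ≤ 1 / Fintype.card A := by positivity
    linarith
  · have : 1 / (Fintype.card A : ℝ) ≤ 1 := by rw [div_le_one (by linarith)]; exact hn
    linarith

theorem abs_regretIncrement_le (t : ℕ) (R : A → A → ℝ) (y : Mixed A) {u M : ℝ} (hu : |u| ≤ M)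
    (b b' : A) :
    |regretIncrement t R y u b b'| ≤ 2 * M * Fintype.card A * (1 / explorationRate t) := by
  have hg := explorationRate_pos t
  have hn : (0 : ℝ) < Fintype.card A := by exact_mod_cast Fintype.card_pos
  have hM : 0 ≤ M := (abs_nonneg u).trans hu
  have key : ∀ c, |y.1 c * u / playProb t R c| ≤ M * Fintype.card A * (1 / explorationRate t) := by
    intro c
    have hz := playProb_pos t R c
    rw [abs_div, abs_mul, abs_of_pos hz, abs_of_nonneg (y.2.1 c), div_le_iff₀ hz]
    have h1 : y.1 c * |u| ≤ 1 * M :=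
      mul_le_mul (le_one_of_mem_stdSimplex y.2 c) hu (abs_nonneg u) zero_le_one
    have h2 := mul_le_mul_of_nonneg_left (explorationRate_div_card_le_playProb t R c)
      (show 0 ≤ M * Fintype.card A * (1 / explorationRate t) by positivity)
    have h3 : M * Fintype.card A * (1 / explorationRate t) *
      (explorationRate t / Fintype.card A) = M := by field_simp
    linarith
  unfold regretIncrement
  rw [abs_mul, abs_of_nonneg ((targetDist_mem_stdSimplex t R).1 b)]
  calc _ ≤ 1 * |y.1 b' * u / playProb t R b' - y.1 b * u / playProb t R b| :=
        mul_le_mul_of_nonneg_right (le_one_of_mem_stdSimplex (targetDist_mem_stdSimplex t R) b)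
          (abs_nonneg _)
    _ ≤ _ := by
        have := abs_sub (y.1 b' * u / playProb t R b') (y.1 b * u / playProb t R b)
        linarith [key b, key b']

/-- The estimated regrets are unbiased. -/
theorem sum_playProb_mul_regretIncrement (t : ℕ) (R : A → A → ℝ) (u : A → ℝ) (b b' : A) :
    ∑ B, playProb t R B * regretIncrement t R (pureStrategy B) (u B) b b' =
      targetDist t R b * (u b' - u b) := by
  have h : ∀ B, playProb t R B * regretIncrement t R (pureStrategy B) (u B) b b' =
      targetDist t R b * (playProb t R B * u B / playProb t R b' * (pureStrategy B).1 b' -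
        playProb t R B * u B / playProb t R b * (pureStrategy B).1 b) := by
    intro B; unfold regretIncrement; ring
  rw [Finset.sum_congr rfl fun B _ => h B, ← Finset.mul_sum, Finset.sum_sub_distrib,
    sum_mul_pureStrategy b' (fun B => playProb t R B * u B / playProb t R b'),
    sum_mul_pureStrategy b (fun B => playProb t R B * u B / playProb t R b)]
  have h1 := (playProb_pos t R b).ne'
  have h2 := (playProb_pos t R b').ne'
  field_simp

/-- The constant in the growth bound for the potential, when there are `n` actions and utilities
are bounded by `M`. -/
def growthConst (n : ℕ) (M : ℝ) : ℝ :=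
  2 * M * n * (1 + n ^ 2 * (2 * M * n)) + n ^ 2 * (2 * M * n) ^ 2

/-- The first-order change of the potential is a combination of net flows, hence small at an
almost stationary distribution. -/
theorem sum_max_mul_sub_eq {A : Type*} [Fintype A] (R : A → A → ℝ) (q u : A → ℝ) :
    ∑ b, ∑ b', max (R b b') 0 * (q b * (u b' - u b)) = ∑ b, u b * netFlow R q b := by
  have h : ∀ b b', max (R b b') 0 * (q b * (u b' - u b)) =
      u b' * (q b * max (R b b') 0) - u b * (q b * max (R b b') 0) := fun b b' => by ring
  simp_rw [h]
  simp only [Finset.sum_sub_distrib, netFlow, mul_sub, Finset.mul_sum]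
  rw [Finset.sum_comm]

theorem sum_playProb_mul_regretPotential_le (t : ℕ) (R : A → A → ℝ) {u : A → ℝ} {M : ℝ}
    (hu : ∀ b, |u b| ≤ M)
    (hR : ∀ b b', |R b b'| ≤ 2 * M * Fintype.card A * (t : ℝ) ^ 2) :
    ∑ B, playProb t R B * regretPotential (R + regretIncrement t R (pureStrategy B) (u B)) ≤
      regretPotential R + growthConst (Fintype.card A) M * ((t : ℝ) + 1) ^ (1 / 2 : ℝ) := by
  set n : ℝ := (Fintype.card A : ℝ) with hn
  have hM : 0 ≤ M := (abs_nonneg _).trans (hu (Classical.arbitrary A))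
  have hn0 : 0 ≤ n := Nat.cast_nonneg _
  set D : A → A → A → ℝ := fun B => regretIncrement t R (pureStrategy B) (u B) with hD
  set S : ℝ := (2 * M * n) ^ 2 * ((t : ℝ) + 1) ^ (1 / 2 : ℝ) with hS
  have hDsq : ∀ B b b', (D B b b') ^ 2 ≤ S := by
    intro B b b'
    have h := abs_regretIncrement_le t R (pureStrategy B) (hu B) b b'
    rw [← sq_abs, hS, ← inv_explorationRate_sq, ← mul_pow]
    exact pow_le_pow_left₀ (abs_nonneg _) h 2
  have hpt : ∀ r d : ℝ, (max (r + d) 0) ^ 2 ≤ (max r 0) ^ 2 + 2 * max r 0 * d + d ^ 2 := by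
    intro r d
    have e : (max r 0) ^ 2 + 2 * max r 0 * d + d ^ 2 = (max r 0 + d) ^ 2 := by ring
    rw [e]
    rcases le_total (r + d) 0 with h | h
    · rw [max_eq_right h]; nlinarith [sq_nonneg (max r 0 + d)]
    · rw [max_eq_left h]
      exact pow_le_pow_left₀ h (by linarith [le_max_left r 0]) 2
  have h1 : ∀ B, regretPotential (R + D B) ≤
      regretPotential R + 2 * ∑ b, ∑ b', max (R b b') 0 * D B b b' + n ^ 2 * S := by
    intro B
    have : regretPotential (R + D B) ≤
        ∑ b, ∑ b', ((max (R b b') 0) ^ 2 + 2 * (max (R b b') 0 * D B b b') + S) := by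
      refine Finset.sum_le_sum fun b _ => Finset.sum_le_sum fun b' _ => ?_
      have := hpt (R b b') (D B b b')
      have := hDsq B b b'
      simp only [Pi.add_apply]
      linarith
    refine this.trans_eq ?_
    simp only [Finset.sum_add_distrib, ← Finset.mul_sum, Finset.sum_const, Finset.card_univ,
      nsmul_eq_mul, ← hn, regretPotential]
    ring
  have h2 : ∑ B, playProb t R B * ∑ b, ∑ b', max (R b b') 0 * D B b b' =
      ∑ b, u b * netFlow R (targetDist t R) b := by
    rw [← sum_max_mul_sub_eq]
    simp only [Finset.mul_sum]
    rw [Finset.sum_comm]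
    refine Finset.sum_congr rfl fun b _ => ?_
    rw [Finset.sum_comm]
    refine Finset.sum_congr rfl fun b' _ => ?_
    rw [← sum_playProb_mul_regretIncrement, Finset.mul_sum]
    exact Finset.sum_congr rfl fun B _ => by ring
  have hscale : flowScale R / ((t + 1) ^ 2 : ℕ) ≤ 1 + n ^ 2 * (2 * M * n) := by
    have ht : (1 : ℝ) ≤ ((t : ℝ) + 1) ^ 2 := one_le_pow₀ (by linarith [Nat.cast_nonneg (α := ℝ) t])
    have ht' : (t : ℝ) ^ 2 ≤ ((t : ℝ) + 1) ^ 2 :=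
      pow_le_pow_left₀ (Nat.cast_nonneg t) (by linarith) 2
    have : flowScale R ≤ 1 + n ^ 2 * (2 * M * n * (t : ℝ) ^ 2) := by
      have h : ∑ b, ∑ c, max (R b c) 0 ≤ ∑ _b : A, ∑ _c : A, (2 * M * n * (t : ℝ) ^ 2) :=
        Finset.sum_le_sum fun b _ => Finset.sum_le_sum fun c _ =>
          max_le ((le_abs_self _).trans (hR b c)) (by positivity)
      simp only [Finset.sum_const, Finset.card_univ, nsmul_eq_mul, ← hn] at h
      unfold flowScale
      linarith
    push_cast
    rw [div_le_iff₀ (by linarith)]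
    have := mul_le_mul_of_nonneg_left ht' (show 0 ≤ n ^ 2 * (2 * M * n) by positivity)
    linarith
  have h3 : ∑ b, u b * netFlow R (targetDist t R) b ≤ M * n * (1 + n ^ 2 * (2 * M * n)) := by
    have : ∀ b ∈ Finset.univ, u b * netFlow R (targetDist t R) b ≤
        M * (1 + n ^ 2 * (2 * M * n)) := by
      intro b _
      refine (le_abs_self _).trans ?_
      rw [abs_mul]
      exact mul_le_mul (hu b) ((abs_netFlow_almostStationary_le R b).trans hscale)
        (abs_nonneg _) hM
    refine (Finset.sum_le_sum this).trans_eq ?_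
    simp only [Finset.sum_const, Finset.card_univ, nsmul_eq_mul, ← hn]
    ring
  have hroot : (1 : ℝ) ≤ ((t : ℝ) + 1) ^ (1 / 2 : ℝ) :=
    Real.one_le_rpow (by linarith [Nat.cast_nonneg (α := ℝ) t]) (by norm_num)
  calc ∑ B, playProb t R B * regretPotential (R + D B)
      ≤ ∑ B, playProb t R B *
        (regretPotential R + 2 * ∑ b, ∑ b', max (R b b') 0 * D B b b' + n ^ 2 * S) :=
        Finset.sum_le_sum fun B _ => mul_le_mul_of_nonneg_left (h1 B) (playProb_pos t R B).le
    _ = (∑ B, playProb t R B) * (regretPotential R + n ^ 2 * S) +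
        2 * ∑ B, playProb t R B * ∑ b, ∑ b', max (R b b') 0 * D B b b' := by
        rw [Finset.sum_mul, Finset.mul_sum, ← Finset.sum_add_distrib]
        exact Finset.sum_congr rfl fun B _ => by ring
    _ ≤ regretPotential R + n ^ 2 * S + 2 * (M * n * (1 + n ^ 2 * (2 * M * n))) := by
        rw [sum_playProb, one_mul, h2]; linarith
    _ ≤ _ := by
        have h4 : 0 ≤ 2 * (M * n * (1 + n ^ 2 * (2 * M * n))) := by positivity
        have := le_mul_of_one_le_right h4 hroot
        unfold growthConst
        rw [hS, ← hn]
        linarith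

end Learner

section LearnerAlgorithm

variable {A : Type*} [Fintype A]

/-- The learner's matrix of estimated cumulative regrets, as a function of her feedback. It uses
only her own strategies and her own utilities, so it is available under bandit feedback. -/
def cumRegret {O : Type*} : (t : ℕ) → (Fin t → Mixed A × O × ℝ) → A → A → ℝ
  | 0, _ => 0
  | t + 1, h =>
    cumRegret t (Fin.init h) + regretIncrement t (cumRegret t (Fin.init h))
      (h (Fin.last t)).1 (h (Fin.last t)).2.2

theorem measurable_targetDist (t : ℕ) (b : A) :
    Measurable fun R : A → A → ℝ => targetDist t R b := by
  have hs : Measurable fun R : A → A → ℝ => flowScale R := by unfold flowScale; fun_prop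
  have hk : ∀ k, Measurable fun R : A → A → ℝ => flowIterate R k := by
    intro k
    induction k with
    | zero => exact measurable_const
    | succ k ih =>
      refine measurable_pi_lambda _ fun c => ?_
      have ih' : ∀ c, Measurable fun R : A → A → ℝ => flowIterate R k c :=
        fun c => (measurable_pi_apply c).comp ih
      simp only [flowIterate, flowStep, netFlow]
      fun_prop
  unfold targetDist almostStationary
  exact (Finset.measurable_sum _ fun k _ => (measurable_pi_apply b).comp (hk k)).const_mul _

theorem measurable_playProb (t : ℕ) (b : A) :
    Measurable fun R : A → A → ℝ => playProb t R b :=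
  ((measurable_targetDist t b).const_mul _).add_const _

theorem measurable_regretIncrement (t : ℕ) :
    Measurable fun z : (A → A → ℝ) × Mixed A × ℝ => regretIncrement t z.1 z.2.1 z.2.2 := by
  refine measurable_pi_lambda _ fun b => measurable_pi_lambda _ fun b' => ?_
  have hy : ∀ c, Measurable fun z : (A → A → ℝ) × Mixed A × ℝ => z.2.1.1 c := fun c =>
    (measurable_pi_apply c).comp
      (measurable_subtype_coe.comp (measurable_fst.comp measurable_snd))
  have hz : ∀ c, Measurable fun z : (A → A → ℝ) × Mixed A × ℝ => playProb t z.1 c := fun c =>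
    (measurable_playProb t c).comp measurable_fst
  have hu : Measurable fun z : (A → A → ℝ) × Mixed A × ℝ => z.2.2 :=
    measurable_snd.comp measurable_snd
  exact ((measurable_targetDist t b).comp measurable_fst).mul
    ((((hy b').mul hu).div (hz b')).sub (((hy b).mul hu).div (hz b)))

theorem measurable_cumRegret {O : Type*} [MeasurableSpace O] (t : ℕ) :
    Measurable (cumRegret t : (Fin t → Mixed A × O × ℝ) → A → A → ℝ) := by
  induction t with
  | zero => exact measurable_const
  | succ t ih =>
    have hi : Measurable fun h : Fin (t + 1) → Mixed A × O × ℝ => cumRegret t (Fin.init h) :=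
      ih.comp (measurable_pi_lambda _ fun r => measurable_pi_apply r.castSucc)
    have hl : Measurable fun h : Fin (t + 1) → Mixed A × O × ℝ => h (Fin.last t) :=
      measurable_pi_apply _
    exact hi.add ((measurable_regretIncrement t).comp (hi.prodMk
      ((measurable_fst.comp hl).prodMk (measurable_snd.comp (measurable_snd.comp hl)))))

/-- The no-swap-regret learner: she ignores her signal and plays the pure action `b` with
probability `playProb t R b`, where `R` is her matrix of estimated regrets. -/
def learner (fb : Feedback) (I A B : Type*) [Fintype A] [Nonempty A] [Fintype B] :
    Algorithm fb I A B where
  kernel _ t :=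
    { toFun := fun h => ∑ b, ENNReal.ofReal (playProb t (cumRegret t h) b) •
        Measure.dirac (pureStrategy b)
      measurable' := by
        refine Measure.measurable_of_measurable_coe _ fun s hs => ?_
        simp only [Measure.coe_finsetSum, Finset.sum_apply, Measure.smul_apply, smul_eq_mul]
        exact Finset.measurable_sum _ fun b _ =>
          ((measurable_playProb t b).comp (measurable_cumRegret t)).ennreal_ofReal.mul_const _ }
  markov _ t := by
    refine ⟨fun h => ⟨?_⟩⟩
    simp only [Kernel.coe_mk, Measure.coe_finsetSum, Finset.sum_apply, Measure.smul_apply,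
      measure_univ, smul_eq_mul, mul_one]
    rw [← ENNReal.ofReal_sum_of_nonneg fun b _ => (playProb_pos t _ b).le, sum_playProb,
      ENNReal.ofReal_one]

variable [Nonempty A]

theorem integral_learner {fb : Feedback} {I B : Type*} [Fintype B] (s : I) (t : ℕ)
    (h : Fin t → fb.Observation (Mixed A) (Mixed B)) {f : Mixed A → ℝ} (hf : Measurable f) :
    ∫ y, f y ∂((learner fb I A B).kernel s t h) =
      ∑ b, playProb t (cumRegret t h) b * f (pureStrategy b) := by
  have hi : ∀ b ∈ Finset.univ, Integrable f
      (ENNReal.ofReal (playProb t (cumRegret t h) b) • Measure.dirac (pureStrategy b)) :=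
    fun b _ => (integrable_dirac' hf.stronglyMeasurable (by simp)).smul_measure
      ENNReal.ofReal_ne_top
  change ∫ y, f y ∂(∑ b, ENNReal.ofReal (playProb t (cumRegret t h) b) •
    Measure.dirac (pureStrategy b)) = _
  rw [integral_finsetSum_measure hi]
  refine Finset.sum_congr rfl fun b _ => ?_
  rw [integral_smul_measure, integral_dirac' _ _ hf.stronglyMeasurable,
    ENNReal.toReal_ofReal (playProb_pos t _ b).le, smul_eq_mul]

end LearnerAlgorithm

/-! ### Expectations over trajectories -/

section Law

variable {A₁ A₂ : Type*} [Fintype A₁] [Fintype A₂] {fb : Feedback} {I : Type*}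

theorem measurable_snoc {α : Type*} [MeasurableSpace α] (T : ℕ) :
    Measurable fun z : (Fin T → α) × α => (Fin.snoc (α := fun _ => α) z.1 z.2 : Fin (T + 1) → α) := by
  refine measurable_pi_lambda _ fun r => ?_
  refine Fin.lastCases ?_ (fun r => ?_) r
  · simpa using measurable_snd
  · simp only [Fin.snoc_castSucc]
    exact (measurable_pi_apply r).comp measurable_fst

instance isMarkovKernel_roundKernel (π₁ : Algorithm fb I A₁ A₂) (π₂ : Algorithm fb I A₂ A₁)
    (G : Game A₁ A₂) (s₁ s₂ : I) (T : ℕ) : IsMarkovKernel (roundKernel π₁ π₂ G s₁ s₂ T) := by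
  have := π₁.markov s₁ T
  have := π₂.markov s₂ T
  unfold roundKernel
  infer_instance

instance isProbabilityMeasure_trajectoryLaw (π₁ : Algorithm fb I A₁ A₂)
    (π₂ : Algorithm fb I A₂ A₁) (G : Game A₁ A₂) (s₁ s₂ : I) (T : ℕ) :
    IsProbabilityMeasure (trajectoryLaw π₁ π₂ G s₁ s₂ T) := by
  induction T with
  | zero => unfold trajectoryLaw; infer_instance
  | succ T ih =>
    unfold trajectoryLaw
    exact Measure.isProbabilityMeasure_map (measurable_snoc T).aemeasurable

theorem integrable_of_abs_le {Ω : Type*} [MeasurableSpace Ω] {μ : Measure Ω} [IsFiniteMeasure μ]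
    {f : Ω → ℝ} (hf : Measurable f) {C : ℝ} (hC : ∀ ω, |f ω| ≤ C) : Integrable f μ :=
  Integrable.of_bound hf.aestronglyMeasurable C (Eventually.of_forall hC)

theorem integral_trajectoryLaw_succ (π₁ : Algorithm fb I A₁ A₂) (π₂ : Algorithm fb I A₂ A₁)
    (G : Game A₁ A₂) (s₁ s₂ : I) (T : ℕ) {F : Trajectory A₁ A₂ (T + 1) → ℝ} (hF : Measurable F)
    {C : ℝ} (hC : ∀ h, |F h| ≤ C) :
    ∫ h, F h ∂(trajectoryLaw π₁ π₂ G s₁ s₂ (T + 1)) =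
      ∫ h, ∫ z, F (Fin.snoc (α := fun _ => Mixed A₁ × Mixed A₂) h z)
        ∂(roundKernel π₁ π₂ G s₁ s₂ T h) ∂(trajectoryLaw π₁ π₂ G s₁ s₂ T) := by
  rw [trajectoryLaw, integral_map (measurable_snoc T).aemeasurable hF.aestronglyMeasurable,
    Measure.integral_compProd]
  exact integrable_of_abs_le (hF.comp (measurable_snoc T)) fun z => hC _

/-- The joint law of the trajectory of the first `T` rounds and of the strategy that the first
player draws in round `T`. -/
def nextLaw (π₁ : Algorithm fb I A₁ A₂) (π₂ : Algorithm fb I A₂ A₁) (G : Game A₁ A₂) (s₁ s₂ : I)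
    (T : ℕ) : Measure (Trajectory A₁ A₂ T × Mixed A₁) :=
  (trajectoryLaw π₁ π₂ G s₁ s₂ T) ⊗ₘ
    ((π₁.kernel s₁ T).comap (history₁ fb G) (measurable_history₁ fb G T))

instance isProbabilityMeasure_nextLaw (π₁ : Algorithm fb I A₁ A₂) (π₂ : Algorithm fb I A₂ A₁)
    (G : Game A₁ A₂) (s₁ s₂ : I) (T : ℕ) : IsProbabilityMeasure (nextLaw π₁ π₂ G s₁ s₂ T) := by
  have := π₁.markov s₁ T
  unfold nextLaw
  infer_instance

theorem integral_nextLaw_fst (π₁ : Algorithm fb I A₁ A₂) (π₂ : Algorithm fb I A₂ A₁)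
    (G : Game A₁ A₂) (s₁ s₂ : I) (T : ℕ) {f : Trajectory A₁ A₂ T → ℝ} (hf : Measurable f)
    {C : ℝ} (hC : ∀ h, |f h| ≤ C) :
    ∫ p, f p.1 ∂(nextLaw π₁ π₂ G s₁ s₂ T) = ∫ h, f h ∂(trajectoryLaw π₁ π₂ G s₁ s₂ T) := by
  have := π₁.markov s₁ T
  unfold nextLaw
  rw [Measure.integral_compProd (f := fun p => f p.1)
    (integrable_of_abs_le (hf.comp measurable_fst) fun z => hC _)]
  simp

/-- The learner's estimated regrets along a trajectory. -/
def trajRegret (fb : Feedback) (G : Game A₁ A₂) {T : ℕ} (h : Trajectory A₁ A₂ T) : A₂ → A₂ → ℝ :=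
  cumRegret T (history₂ fb G h)

theorem measurable_trajRegret (fb : Feedback) (G : Game A₁ A₂) (T : ℕ) :
    Measurable (trajRegret fb G : Trajectory A₁ A₂ T → _) :=
  (measurable_cumRegret T).comp (measurable_history₂ fb G T)

theorem trajRegret_snoc (fb : Feedback) (G : Game A₁ A₂) {T : ℕ} (h : Trajectory A₁ A₂ T)
    (z : Mixed A₁ × Mixed A₂) :
    trajRegret fb G (Fin.snoc (α := fun _ => Mixed A₁ × Mixed A₂) h z : Trajectory A₁ A₂ (T + 1)) =
      trajRegret fb G h + regretIncrement T (trajRegret fb G h) z.2 (G.eu₂ z.1 z.2) := by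
  have h1 : Fin.init (history₂ fb G (Fin.snoc (α := fun _ => Mixed A₁ × Mixed A₂) h z :
      Trajectory A₁ A₂ (T + 1))) = history₂ fb G h := by
    funext r
    simp [Fin.init, history₂]
  have h2 : history₂ fb G (Fin.snoc (α := fun _ => Mixed A₁ × Mixed A₂) h z :
      Trajectory A₁ A₂ (T + 1)) (Fin.last T) = (z.2, fb.view z.1, G.eu₂ z.1 z.2) := by
    simp [history₂]
  unfold trajRegret
  rw [cumRegret, h1, h2]

variable [Nonempty A₂]

/-- One more round against the learner. -/
theorem integral_trajectoryLaw_learner_succ (π₁ : Algorithm fb I A₁ A₂) (G : Game A₁ A₂)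
    (s₁ s₂ : I) (T : ℕ) {F : Trajectory A₁ A₂ (T + 1) → ℝ} (hF : Measurable F)
    {C : ℝ} (hC : ∀ h, |F h| ≤ C) :
    ∫ h, F h ∂(trajectoryLaw π₁ (learner fb I A₂ A₁) G s₁ s₂ (T + 1)) =
      ∫ p, ∑ b, playProb T (trajRegret fb G p.1) b *
        F (Fin.snoc (α := fun _ => Mixed A₁ × Mixed A₂) p.1 (p.2, pureStrategy b))
        ∂(nextLaw π₁ (learner fb I A₂ A₁) G s₁ s₂ T) := by
  have := π₁.markov s₁ T
  have := (learner fb I A₂ A₁).markov s₂ T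
  have hm : ∀ b : A₂, Measurable fun p : Trajectory A₁ A₂ T × Mixed A₁ =>
      F (Fin.snoc (α := fun _ => Mixed A₁ × Mixed A₂) p.1 (p.2, pureStrategy b)) := fun b =>
    hF.comp ((measurable_snoc T).comp
      (measurable_fst.prodMk (measurable_snd.prodMk measurable_const)))
  have hp : ∀ b : A₂, Measurable fun p : Trajectory A₁ A₂ T × Mixed A₁ =>
      playProb T (trajRegret fb G p.1) b := fun b =>
    (measurable_playProb T b).comp ((measurable_trajRegret fb G T).comp measurable_fst)
  have hint : Integrable (fun p : Trajectory A₁ A₂ T × Mixed A₁ =>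
      ∑ b, playProb T (trajRegret fb G p.1) b *
        F (Fin.snoc (α := fun _ => Mixed A₁ × Mixed A₂) p.1 (p.2, pureStrategy b)))
      (nextLaw π₁ (learner fb I A₂ A₁) G s₁ s₂ T) := by
    refine integrable_of_abs_le (C := C) (Finset.measurable_sum _ fun b _ => (hp b).mul (hm b))
      fun p => ?_
    refine (Finset.abs_sum_le_sum_abs _ _).trans ?_
    calc ∑ b, |playProb T (trajRegret fb G p.1) b *
          F (Fin.snoc (α := fun _ => Mixed A₁ × Mixed A₂) p.1 (p.2, pureStrategy b))|
        ≤ ∑ b, playProb T (trajRegret fb G p.1) b * C := by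
          refine Finset.sum_le_sum fun b _ => ?_
          rw [abs_mul, abs_of_pos (playProb_pos T _ b)]
          exact mul_le_mul_of_nonneg_left (hC _) (playProb_pos T _ b).le
      _ = C := by rw [← Finset.sum_mul, sum_playProb, one_mul]
  rw [integral_trajectoryLaw_succ _ _ _ _ _ _ hF hC, nextLaw, Measure.integral_compProd hint]
  refine integral_congr_ae (Eventually.of_forall fun h => ?_)
  simp only [roundKernel]
  rw [Kernel.prod_apply, integral_prod]
  · simp only [Kernel.comap_apply]
    refine integral_congr_ae (Eventually.of_forall fun x => ?_)
    exact integral_learner s₂ T (history₂ fb G h)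
      (f := fun y => F (Fin.snoc (α := fun _ => Mixed A₁ × Mixed A₂) h (x, y)))
      (hF.comp ((measurable_snoc T).comp
        (measurable_const.prodMk (measurable_const.prodMk measurable_id))))
  · exact integrable_of_abs_le (hF.comp ((measurable_snoc T).comp
      (measurable_const.prodMk measurable_id))) fun z => hC _

end Law

/-! ### Mixed payoffs -/

section Bilinear

variable {A₁ A₂ : Type*} [Fintype A₁] [Fintype A₂]

/-- The bilinear extension of a payoff matrix to mixed strategies; `Game.eu₁` and `Game.eu₂` are
its instances for `U₁` and `U₂`. -/
def mixedPayoff (V : A₁ → A₂ → ℝ) (x : Mixed A₁) (y : Mixed A₂) : ℝ :=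
  ∑ a, ∑ b, x.1 a * y.1 b * V a b

/-- The sum of the absolute values of the entries, a bound for all payoffs. -/
def payoffBound (V : A₁ → A₂ → ℝ) : ℝ := ∑ a, ∑ b, |V a b|

theorem payoffBound_nonneg (V : A₁ → A₂ → ℝ) : 0 ≤ payoffBound V :=
  Finset.sum_nonneg fun _ _ => Finset.sum_nonneg fun _ _ => abs_nonneg _

theorem measurable_mixedPayoff (V : A₁ → A₂ → ℝ) :
    Measurable fun z : Mixed A₁ × Mixed A₂ => mixedPayoff V z.1 z.2 :=
  (Game.mk V V).measurable_eu₁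

theorem abs_mixedPayoff_le (V : A₁ → A₂ → ℝ) (x : Mixed A₁) (y : Mixed A₂) :
    |mixedPayoff V x y| ≤ payoffBound V := by
  refine (Finset.abs_sum_le_sum_abs _ _).trans (Finset.sum_le_sum fun a _ =>
    (Finset.abs_sum_le_sum_abs _ _).trans (Finset.sum_le_sum fun b _ => ?_))
  rw [abs_mul, abs_of_nonneg (mul_nonneg (x.2.1 a) (y.2.1 b))]
  exact mul_le_of_le_one_left (abs_nonneg _) (mul_le_one₀ (le_one_of_mem_stdSimplex x.2 a)
    (y.2.1 b) (le_one_of_mem_stdSimplex y.2 b))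

theorem mixedPayoff_pureStrategy (V : A₁ → A₂ → ℝ) (x : Mixed A₁) (b : A₂) :
    mixedPayoff V x (pureStrategy b) = ∑ a, x.1 a * V a b := by
  refine Finset.sum_congr rfl fun a _ => ?_
  rw [← sum_pureStrategy_mul b fun c => x.1 a * V a c]
  exact Finset.sum_congr rfl fun c _ => by ring

theorem mixedPayoff_eq_sum (V : A₁ → A₂ → ℝ) (x : Mixed A₁) (y : Mixed A₂) :
    mixedPayoff V x y = ∑ b, y.1 b * ∑ a, x.1 a * V a b := by
  unfold mixedPayoff
  rw [Finset.sum_comm]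
  refine Finset.sum_congr rfl fun b _ => ?_
  rw [Finset.mul_sum]
  exact Finset.sum_congr rfl fun a _ => by ring

theorem measurable_sum_mixedPayoff (V : A₁ → A₂ → ℝ) (T : ℕ) :
    Measurable fun h : Trajectory A₁ A₂ T => ∑ t, mixedPayoff V (h t).1 (h t).2 :=
  Finset.measurable_sum _ fun t _ => (measurable_mixedPayoff V).comp (measurable_pi_apply t)

theorem abs_sum_mixedPayoff_le (V : A₁ → A₂ → ℝ) {T : ℕ} (h : Trajectory A₁ A₂ T) :
    |∑ t, mixedPayoff V (h t).1 (h t).2| ≤ T * payoffBound V := by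
  refine (Finset.abs_sum_le_sum_abs _ _).trans
    ((Finset.sum_le_sum fun t _ => abs_mixedPayoff_le V (h t).1 (h t).2).trans_eq ?_)
  simp

theorem sum_mixedPayoff_snoc (V : A₁ → A₂ → ℝ) {T : ℕ} (h : Trajectory A₁ A₂ T)
    (z : Mixed A₁ × Mixed A₂) :
    ∑ t, mixedPayoff V
      ((Fin.snoc (α := fun _ => Mixed A₁ × Mixed A₂) h z : Trajectory A₁ A₂ (T + 1)) t).1
      ((Fin.snoc (α := fun _ => Mixed A₁ × Mixed A₂) h z : Trajectory A₁ A₂ (T + 1)) t).2 =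
      ∑ t, mixedPayoff V (h t).1 (h t).2 + mixedPayoff V z.1 z.2 := by
  rw [Fin.sum_univ_castSucc]
  simp

end Bilinear

/-! ### Regret of the learner -/

section Regret

variable {A₁ A₂ : Type*} [Fintype A₁] [Fintype A₂] {fb : Feedback} {I : Type*}

theorem measurable_trajRegret_apply (fb : Feedback) (G : Game A₁ A₂) (T : ℕ) (b b' : A₂) :
    Measurable fun h : Trajectory A₁ A₂ T => trajRegret fb G h b b' :=
  (measurable_pi_apply b').comp ((measurable_pi_apply b).comp (measurable_trajRegret fb G T))

theorem measurable_targetDist_mul (fb : Feedback) (G : Game A₁ A₂) (t : ℕ) (b : A₂) (a : A₁) :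
    Measurable fun p : Trajectory A₁ A₂ t × Mixed A₁ =>
      targetDist t (trajRegret fb G p.1) b * p.2.1 a :=
  ((measurable_targetDist t b).comp ((measurable_trajRegret fb G t).comp measurable_fst)).mul
    ((measurable_pi_apply a).comp (measurable_subtype_coe.comp measurable_snd))

theorem measurable_regretPotential (fb : Feedback) (G : Game A₁ A₂) (T : ℕ) :
    Measurable fun h : Trajectory A₁ A₂ T => regretPotential (trajRegret fb G h) :=
  Finset.measurable_sum _ fun b _ => Finset.measurable_sum _ fun b' _ =>
    ((measurable_trajRegret_apply fb G T b b').max measurable_const).pow_const 2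

variable [Nonempty A₂]

theorem abs_trajRegret_le (fb : Feedback) (G : Game A₁ A₂) {T : ℕ} (h : Trajectory A₁ A₂ T)
    (b b' : A₂) :
    |trajRegret fb G h b b'| ≤ 2 * payoffBound G.U₂ * Fintype.card A₂ * (T : ℝ) ^ 2 := by
  induction T with
  | zero => simp [trajRegret, cumRegret]
  | succ T ih =>
    have hM := payoffBound_nonneg G.U₂
    rw [← Fin.snoc_init_self h, trajRegret_snoc]
    have h1 := ih (Fin.init h)
    have h2 := abs_regretIncrement_le T (trajRegret fb G (Fin.init h)) (h (Fin.last T)).2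
      (abs_mixedPayoff_le G.U₂ (h (Fin.last T)).1 (h (Fin.last T)).2) b b'
    have h3 := mul_le_mul_of_nonneg_left (inv_explorationRate_le T)
      (show 0 ≤ 2 * payoffBound G.U₂ * (Fintype.card A₂ : ℝ) by positivity)
    refine (abs_add_le _ _).trans ((add_le_add h1 (h2.trans h3)).trans ?_)
    rw [← mul_add]
    refine mul_le_mul_of_nonneg_left ?_ (by positivity)
    push_cast
    nlinarith [Nat.cast_nonneg (α := ℝ) T]

/-- The expected weight that the learner's target distributions put on `b` while the first player
puts weight on `a`, summed over the first `T` rounds. -/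
def occupation (π₁ : Algorithm fb I A₁ A₂) (G : Game A₁ A₂) (s₁ s₂ : I) (T : ℕ) (b : A₂)
    (a : A₁) : ℝ :=
  ∑ t ∈ Finset.range T, ∫ p, targetDist t (trajRegret fb G p.1) b * p.2.1 a
    ∂(nextLaw π₁ (learner fb I A₂ A₁) G s₁ s₂ t)

theorem targetDist_mul_nonneg (fb : Feedback) (G : Game A₁ A₂) (t : ℕ) (b : A₂) (a : A₁)
    (p : Trajectory A₁ A₂ t × Mixed A₁) :
    0 ≤ targetDist t (trajRegret fb G p.1) b * p.2.1 a :=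
  mul_nonneg ((targetDist_mem_stdSimplex t _).1 b) (p.2.2.1 a)

theorem abs_targetDist_mul_le (fb : Feedback) (G : Game A₁ A₂) (t : ℕ) (b : A₂) (a : A₁)
    (p : Trajectory A₁ A₂ t × Mixed A₁) :
    |targetDist t (trajRegret fb G p.1) b * p.2.1 a| ≤ 1 := by
  rw [abs_of_nonneg (targetDist_mul_nonneg fb G t b a p)]
  exact mul_le_one₀ (le_one_of_mem_stdSimplex (targetDist_mem_stdSimplex t _) b) (p.2.2.1 a)
    (le_one_of_mem_stdSimplex p.2.2 a)

theorem integrable_targetDist_mul (π₁ : Algorithm fb I A₁ A₂) (G : Game A₁ A₂) (s₁ s₂ : I)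
    (t : ℕ) (b : A₂) (a : A₁) :
    Integrable (fun p => targetDist t (trajRegret fb G p.1) b * p.2.1 a)
      (nextLaw π₁ (learner fb I A₂ A₁) G s₁ s₂ t) :=
  integrable_of_abs_le (measurable_targetDist_mul fb G t b a) (abs_targetDist_mul_le fb G t b a)

theorem occupation_nonneg (π₁ : Algorithm fb I A₁ A₂) (G : Game A₁ A₂) (s₁ s₂ : I) (T : ℕ)
    (b : A₂) (a : A₁) : 0 ≤ occupation π₁ G s₁ s₂ T b a :=
  Finset.sum_nonneg fun t _ => integral_nonneg fun p => targetDist_mul_nonneg fb G t b a p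

/-- Sums against one round of the occupation weights, as expectations. -/
theorem sum_integral_targetDist_mul (π₁ : Algorithm fb I A₁ A₂) (G : Game A₁ A₂) (s₁ s₂ : I)
    (t : ℕ) (V : A₁ → A₂ → ℝ) :
    ∑ b, ∑ a, (∫ p, targetDist t (trajRegret fb G p.1) b * p.2.1 a
      ∂(nextLaw π₁ (learner fb I A₂ A₁) G s₁ s₂ t)) * V a b =
    ∫ p, ∑ b, targetDist t (trajRegret fb G p.1) b * ∑ a, p.2.1 a * V a b
      ∂(nextLaw π₁ (learner fb I A₂ A₁) G s₁ s₂ t) := by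
  have hint := fun b a => (integrable_targetDist_mul π₁ G s₁ s₂ t b a).mul_const (V a b)
  simp only [Finset.mul_sum, ← mul_assoc]
  rw [integral_finsetSum _ fun b _ => integrable_finsetSum _ fun a _ => hint b a]
  refine Finset.sum_congr rfl fun b _ => ?_
  rw [integral_finsetSum _ fun a _ => hint b a]
  exact Finset.sum_congr rfl fun a _ => (integral_mul_const _ _).symm

theorem sum_occupation (π₁ : Algorithm fb I A₁ A₂) (G : Game A₁ A₂) (s₁ s₂ : I) (T : ℕ) :
    ∑ b, ∑ a, occupation π₁ G s₁ s₂ T b a = T := by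
  have h : ∀ t, ∑ b, ∑ a, (∫ p, targetDist t (trajRegret fb G p.1) b * p.2.1 a
      ∂(nextLaw π₁ (learner fb I A₂ A₁) G s₁ s₂ t)) = 1 := by
    intro t
    have := sum_integral_targetDist_mul π₁ G s₁ s₂ t (fun _ _ => 1)
    simp only [mul_one] at this
    rw [this]
    have h1 : ∀ p : Trajectory A₁ A₂ t × Mixed A₁,
        ∑ b, targetDist t (trajRegret fb G p.1) b * ∑ a, p.2.1 a = 1 := by
      intro p
      rw [p.2.2.2, ← Finset.sum_mul, (targetDist_mem_stdSimplex t _).2, one_mul]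
    simp only [h1]
    simp
  unfold occupation
  have e : ∀ b, ∑ a, ∑ t ∈ Finset.range T, (∫ p, targetDist t (trajRegret fb G p.1) b * p.2.1 a
      ∂(nextLaw π₁ (learner fb I A₂ A₁) G s₁ s₂ t)) = ∑ t ∈ Finset.range T, ∑ a,
      (∫ p, targetDist t (trajRegret fb G p.1) b * p.2.1 a
      ∂(nextLaw π₁ (learner fb I A₂ A₁) G s₁ s₂ t)) := fun b => Finset.sum_comm
  simp only [e]
  rw [Finset.sum_comm]
  simp [h]

/-- The expected estimated regret is the true regret of the target distributions. -/
theorem integral_trajRegret (π₁ : Algorithm fb I A₁ A₂) (G : Game A₁ A₂) (s₁ s₂ : I) (T : ℕ)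
    (b b' : A₂) :
    ∫ h, trajRegret fb G h b b' ∂(trajectoryLaw π₁ (learner fb I A₂ A₁) G s₁ s₂ T) =
      ∑ a, occupation π₁ G s₁ s₂ T b a * (G.U₂ a b' - G.U₂ a b) := by
  induction T with
  | zero => simp [trajRegret, cumRegret, occupation]
  | succ T ih =>
    have hint := fun a =>
      (integrable_targetDist_mul π₁ G s₁ s₂ T b a).mul_const (G.U₂ a b' - G.U₂ a b)
    have hR : Integrable (fun p => trajRegret fb G p.1 b b')
        (nextLaw π₁ (learner fb I A₂ A₁) G s₁ s₂ T) :=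
      integrable_of_abs_le ((measurable_trajRegret_apply fb G T b b').comp measurable_fst)
        fun p => abs_trajRegret_le fb G p.1 b b'
    rw [integral_trajectoryLaw_learner_succ π₁ G s₁ s₂ T
      (measurable_trajRegret_apply fb G (T + 1) b b') fun h => abs_trajRegret_le fb G h b b']
    have hpt : ∀ p : Trajectory A₁ A₂ T × Mixed A₁,
        ∑ B, playProb T (trajRegret fb G p.1) B *
          trajRegret fb G (Fin.snoc (α := fun _ => Mixed A₁ × Mixed A₂) p.1
            (p.2, pureStrategy B) : Trajectory A₁ A₂ (T + 1)) b b' =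
        trajRegret fb G p.1 b b' + ∑ a, targetDist T (trajRegret fb G p.1) b * p.2.1 a *
          (G.U₂ a b' - G.U₂ a b) := by
      intro p
      simp only [trajRegret_snoc, Pi.add_apply, mul_add, Finset.sum_add_distrib]
      rw [← Finset.sum_mul, sum_playProb, one_mul]
      congr 1
      have : ∀ B, G.eu₂ p.2 (pureStrategy B) = ∑ a, p.2.1 a * G.U₂ a B :=
        mixedPayoff_pureStrategy G.U₂ p.2
      simp only [this]
      rw [sum_playProb_mul_regretIncrement T (trajRegret fb G p.1)
        (fun B => ∑ a, p.2.1 a * G.U₂ a B) b b', ← Finset.sum_sub_distrib, Finset.mul_sum]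
      exact Finset.sum_congr rfl fun a _ => by ring
    simp only [hpt]
    rw [integral_add hR (integrable_finsetSum _ fun a _ => hint a),
      integral_nextLaw_fst π₁ _ G s₁ s₂ T (measurable_trajRegret_apply fb G T b b')
        (fun h => abs_trajRegret_le fb G h b b'), ih, integral_finsetSum _ fun a _ => hint a,
      ← Finset.sum_add_distrib]
    refine Finset.sum_congr rfl fun a _ => ?_
    rw [integral_mul_const, ← add_mul]
    simp only [occupation, Finset.sum_range_succ]

theorem exists_regretPotential_le (fb : Feedback) (G : Game A₁ A₂) (T : ℕ) :
    ∃ C, ∀ h : Trajectory A₁ A₂ T, |regretPotential (trajRegret fb G h)| ≤ C := by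
  refine ⟨∑ _b : A₂, ∑ _c : A₂, (2 * payoffBound G.U₂ * Fintype.card A₂ * (T : ℝ) ^ 2) ^ 2,
    fun h => ?_⟩
  rw [abs_of_nonneg (Finset.sum_nonneg fun b _ => Finset.sum_nonneg fun c _ => sq_nonneg _)]
  have hM := payoffBound_nonneg G.U₂
  refine Finset.sum_le_sum fun b _ => Finset.sum_le_sum fun c _ =>
    pow_le_pow_left₀ (le_max_right _ _) (max_le ?_ (by positivity)) 2
  exact (le_abs_self _).trans (abs_trajRegret_le fb G h b c)

theorem integral_regretPotential_le (π₁ : Algorithm fb I A₁ A₂) (G : Game A₁ A₂) (s₁ s₂ : I)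
    (T : ℕ) :
    ∫ h, regretPotential (trajRegret fb G h)
        ∂(trajectoryLaw π₁ (learner fb I A₂ A₁) G s₁ s₂ T) ≤
      growthConst (Fintype.card A₂) (payoffBound G.U₂) *
        ∑ t ∈ Finset.range T, ((t : ℝ) + 1) ^ (1 / 2 : ℝ) := by
  induction T with
  | zero => simp [trajRegret, cumRegret, regretPotential]
  | succ T ih =>
    set K := growthConst (Fintype.card A₂) (payoffBound G.U₂)
    obtain ⟨C, hC⟩ := exists_regretPotential_le fb G T
    obtain ⟨C', hC'⟩ := exists_regretPotential_le fb G (T + 1)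
    have hΦ : Integrable (fun p => regretPotential (trajRegret fb G p.1))
        (nextLaw π₁ (learner fb I A₂ A₁) G s₁ s₂ T) :=
      integrable_of_abs_le ((measurable_regretPotential fb G T).comp measurable_fst)
        fun p => hC p.1
    rw [integral_trajectoryLaw_learner_succ π₁ G s₁ s₂ T
      (measurable_regretPotential fb G (T + 1)) hC', Finset.sum_range_succ, mul_add]
    have hle : ∀ p : Trajectory A₁ A₂ T × Mixed A₁,
        ∑ B, playProb T (trajRegret fb G p.1) B *
          regretPotential (trajRegret fb G (Fin.snoc (α := fun _ => Mixed A₁ × Mixed A₂) p.1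
            (p.2, pureStrategy B) : Trajectory A₁ A₂ (T + 1))) ≤
        regretPotential (trajRegret fb G p.1) + K * ((T : ℝ) + 1) ^ (1 / 2 : ℝ) := by
      intro p
      simp only [trajRegret_snoc]
      exact sum_playProb_mul_regretPotential_le T (trajRegret fb G p.1)
        (u := fun B => G.eu₂ p.2 (pureStrategy B))
        (fun B => abs_mixedPayoff_le G.U₂ p.2 (pureStrategy B))
        (abs_trajRegret_le fb G p.1)
    have hmono := integral_mono_of_nonneg (μ := nextLaw π₁ (learner fb I A₂ A₁) G s₁ s₂ T)
      (Eventually.of_forall fun p => Finset.sum_nonneg fun B _ => mul_nonneg (playProb_pos T _ B).le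
        (Finset.sum_nonneg fun b _ => Finset.sum_nonneg fun c _ => sq_nonneg _))
      (hΦ.add (integrable_const _)) (Eventually.of_forall hle)
    refine hmono.trans ?_
    rw [integral_add' hΦ (integrable_const _), integral_nextLaw_fst π₁ _ G s₁ s₂ T
      (measurable_regretPotential fb G T) hC]
    simp only [integral_const, probReal_univ, one_smul]
    linarith

/-- The learner has no swap regret: switching from `b` to `b'` on all rounds in which she aims at
`b` gains at most a sublinear amount. -/
theorem sum_occupation_mul_sub_le (π₁ : Algorithm fb I A₁ A₂) (G : Game A₁ A₂) (s₁ s₂ : I)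
    (T : ℕ) (b b' : A₂) :
    ∑ a, occupation π₁ G s₁ s₂ T b a * (G.U₂ a b' - G.U₂ a b) ≤
      (growthConst (Fintype.card A₂) (payoffBound G.U₂) + 2) * (T : ℝ) ^ (3 / 4 : ℝ) := by
  rw [← integral_trajRegret]
  rcases Nat.eq_zero_or_pos T with rfl | hT
  · simp [trajRegret, cumRegret]
  set K := growthConst (Fintype.card A₂) (payoffBound G.U₂) with hK
  have hK0 : 0 ≤ K := by
    have hM := payoffBound_nonneg G.U₂
    rw [hK]; unfold growthConst; positivity
  have hT' : (0 : ℝ) < T := by exact_mod_cast hT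
  set τ := (T : ℝ) ^ (3 / 4 : ℝ) with hτ
  have hτ0 : 0 < τ := Real.rpow_pos_of_pos hT' _
  have hτ2 : τ ^ 2 = T * (T : ℝ) ^ (1 / 2 : ℝ) := by
    rw [hτ, ← Real.rpow_natCast, ← Real.rpow_mul hT'.le]
    nth_rewrite 2 [← Real.rpow_one (T : ℝ)]
    rw [← Real.rpow_add hT']
    norm_num
  have hΦ : ∫ h, regretPotential (trajRegret fb G h)
      ∂(trajectoryLaw π₁ (learner fb I A₂ A₁) G s₁ s₂ T) ≤ K * τ ^ 2 := by
    refine (integral_regretPotential_le π₁ G s₁ s₂ T).trans (mul_le_mul_of_nonneg_left ?_ hK0)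
    rw [hτ2]
    have : ∀ t ∈ Finset.range T, ((t : ℝ) + 1) ^ (1 / 2 : ℝ) ≤ (T : ℝ) ^ (1 / 2 : ℝ) := by
      intro t ht
      refine Real.rpow_le_rpow (by positivity) ?_ (by norm_num)
      exact_mod_cast Finset.mem_range.1 ht
    simpa using Finset.sum_le_sum this
  obtain ⟨C, hC⟩ := exists_regretPotential_le fb G T
  have hint : Integrable (fun h => regretPotential (trajRegret fb G h))
      (trajectoryLaw π₁ (learner fb I A₂ A₁) G s₁ s₂ T) :=
    integrable_of_abs_le (measurable_regretPotential fb G T) hC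
  -- Jensen's inequality for the square, in the form of its tangent at the scale `τ`.
  have hle : ∀ h : Trajectory A₁ A₂ T,
      trajRegret fb G h b b' ≤ τ + 1 / τ * regretPotential (trajRegret fb G h) := by
    intro h
    set r := max (trajRegret fb G h b b') 0 with hr
    have h1 : r ^ 2 ≤ regretPotential (trajRegret fb G h) :=
      (Finset.single_le_sum (f := fun c => (max (trajRegret fb G h b c) 0) ^ 2)
        (fun c _ => sq_nonneg _) (Finset.mem_univ b')).trans
        (Finset.single_le_sum (f := fun b => ∑ c, (max (trajRegret fb G h b c) 0) ^ 2)
          (fun b _ => Finset.sum_nonneg fun c _ => sq_nonneg _) (Finset.mem_univ b))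
    have h2 : trajRegret fb G h b b' ≤ r := le_max_left _ _
    have h3 : r ≤ τ + 1 / τ * r ^ 2 := by
      have : τ + 1 / τ * r ^ 2 - r = ((τ - r) ^ 2 + τ * r) / τ := by field_simp; ring
      have : 0 ≤ τ + 1 / τ * r ^ 2 - r := by
        rw [this]
        have : 0 ≤ r := le_max_right _ _
        positivity
      linarith
    have h4 := mul_le_mul_of_nonneg_left h1 (show 0 ≤ 1 / τ by positivity)
    linarith
  have hR : Integrable (fun h => trajRegret fb G h b b')
      (trajectoryLaw π₁ (learner fb I A₂ A₁) G s₁ s₂ T) :=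
    integrable_of_abs_le (measurable_trajRegret_apply fb G T b b')
      fun h => abs_trajRegret_le fb G h b b'
  refine (integral_mono hR ((integrable_const τ).add (hint.const_mul _)) hle).trans ?_
  rw [integral_add' (integrable_const τ) (hint.const_mul _), integral_const_mul]
  simp only [integral_const, probReal_univ, one_smul]
  have := mul_le_mul_of_nonneg_left hΦ (show 0 ≤ 1 / τ by positivity)
  have e : 1 / τ * (K * τ ^ 2) = K * τ := by field_simp
  nlinarith

/-- Expected total payoffs are computed by the occupation weights, up to the cost of
exploration. -/
theorem abs_integral_sum_sub_le (π₁ : Algorithm fb I A₁ A₂) (G : Game A₁ A₂) (s₁ s₂ : I) (T : ℕ)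
    (V : A₁ → A₂ → ℝ) :
    |∫ h, ∑ t, mixedPayoff V (h t).1 (h t).2
        ∂(trajectoryLaw π₁ (learner fb I A₂ A₁) G s₁ s₂ T) -
      ∑ b, ∑ a, occupation π₁ G s₁ s₂ T b a * V a b| ≤
      payoffBound V * ∑ t ∈ Finset.range T, explorationRate t := by
  induction T with
  | zero => simp [occupation]
  | succ T ih =>
    set ν := nextLaw π₁ (learner fb I A₂ A₁) G s₁ s₂ T with hν
    have hmS : Measurable fun p : Trajectory A₁ A₂ T × Mixed A₁ =>
        ∑ t, mixedPayoff V (p.1 t).1 (p.1 t).2 :=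
      (measurable_sum_mixedPayoff V T).comp measurable_fst
    have hS : Integrable (fun p : Trajectory A₁ A₂ T × Mixed A₁ =>
        ∑ t, mixedPayoff V (p.1 t).1 (p.1 t).2) ν :=
      integrable_of_abs_le hmS fun p => abs_sum_mixedPayoff_le V p.1
    have hmx : ∀ b, Measurable fun p : Trajectory A₁ A₂ T × Mixed A₁ =>
        ∑ a, p.2.1 a * V a b := fun b => Finset.measurable_sum _ fun a _ =>
      ((measurable_pi_apply a).comp (measurable_subtype_coe.comp measurable_snd)).mul_const _
    have hbx : ∀ (x : Mixed A₁) (b), |∑ a, x.1 a * V a b| ≤ ∑ a, |V a b| := by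
      intro x b
      refine (Finset.abs_sum_le_sum_abs _ _).trans (Finset.sum_le_sum fun a _ => ?_)
      rw [abs_mul, abs_of_nonneg (x.2.1 a)]
      exact mul_le_of_le_one_left (abs_nonneg _) (le_one_of_mem_stdSimplex x.2 a)
    have hsum : ∑ b, ∑ a, |V a b| = payoffBound V := Finset.sum_comm
    have hP : Integrable (fun p : Trajectory A₁ A₂ T × Mixed A₁ =>
        ∑ b, playProb T (trajRegret fb G p.1) b * ∑ a, p.2.1 a * V a b) ν := by
      refine integrable_of_abs_le (C := payoffBound V) (Finset.measurable_sum _ fun b _ =>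
        ((measurable_playProb T b).comp ((measurable_trajRegret fb G T).comp measurable_fst)).mul
          (hmx b)) fun p => ?_
      rw [← hsum]
      refine (Finset.abs_sum_le_sum_abs _ _).trans (Finset.sum_le_sum fun b _ => ?_)
      rw [abs_mul, abs_of_pos (playProb_pos T _ b)]
      refine (mul_le_of_le_one_left (abs_nonneg _) ?_).trans (hbx p.2 b)
      rw [← sum_playProb T (trajRegret fb G p.1)]
      exact Finset.single_le_sum (fun b _ => (playProb_pos T _ b).le) (Finset.mem_univ b)
    have hQ : Integrable (fun p : Trajectory A₁ A₂ T × Mixed A₁ =>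
        ∑ b, targetDist T (trajRegret fb G p.1) b * ∑ a, p.2.1 a * V a b) ν := by
      refine integrable_of_abs_le (C := payoffBound V) (Finset.measurable_sum _ fun b _ =>
        ((measurable_targetDist T b).comp ((measurable_trajRegret fb G T).comp measurable_fst)).mul
          (hmx b)) fun p => ?_
      rw [← hsum]
      refine (Finset.abs_sum_le_sum_abs _ _).trans (Finset.sum_le_sum fun b _ => ?_)
      have hq := targetDist_mem_stdSimplex T (trajRegret fb G p.1)
      rw [abs_mul, abs_of_nonneg (hq.1 b)]
      exact (mul_le_of_le_one_left (abs_nonneg _) (le_one_of_mem_stdSimplex hq b)).trans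
        (hbx p.2 b)
    have h1 : ∫ h, ∑ t, mixedPayoff V (h t).1 (h t).2
        ∂(trajectoryLaw π₁ (learner fb I A₂ A₁) G s₁ s₂ (T + 1)) =
        ∫ h, ∑ t, mixedPayoff V (h t).1 (h t).2
          ∂(trajectoryLaw π₁ (learner fb I A₂ A₁) G s₁ s₂ T) +
        ∫ p, ∑ b, playProb T (trajRegret fb G p.1) b * ∑ a, p.2.1 a * V a b ∂ν := by
      rw [integral_trajectoryLaw_learner_succ π₁ G s₁ s₂ T (measurable_sum_mixedPayoff V (T + 1))
        (abs_sum_mixedPayoff_le V), ← integral_nextLaw_fst π₁ (learner fb I A₂ A₁) G s₁ s₂ T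
        (measurable_sum_mixedPayoff V T) (abs_sum_mixedPayoff_le V), ← hν, ← integral_add hS hP]
      refine integral_congr_ae (Eventually.of_forall fun p => ?_)
      simp only [sum_mixedPayoff_snoc, mul_add, Finset.sum_add_distrib, mixedPayoff_pureStrategy]
      rw [← Finset.sum_mul, sum_playProb, one_mul]
    have h2 : ∑ b, ∑ a, occupation π₁ G s₁ s₂ (T + 1) b a * V a b =
        ∑ b, ∑ a, occupation π₁ G s₁ s₂ T b a * V a b +
        ∫ p, ∑ b, targetDist T (trajRegret fb G p.1) b * ∑ a, p.2.1 a * V a b ∂ν := by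
      rw [hν, ← sum_integral_targetDist_mul]
      simp only [← Finset.sum_add_distrib, ← add_mul]
      simp only [occupation, Finset.sum_range_succ]
    have h3 : |∫ p, ∑ b, playProb T (trajRegret fb G p.1) b * ∑ a, p.2.1 a * V a b ∂ν -
        ∫ p, ∑ b, targetDist T (trajRegret fb G p.1) b * ∑ a, p.2.1 a * V a b ∂ν| ≤
        payoffBound V * explorationRate T := by
      rw [← integral_sub hP hQ]
      have hb : ∀ p : Trajectory A₁ A₂ T × Mixed A₁,
          ‖∑ b, playProb T (trajRegret fb G p.1) b * ∑ a, p.2.1 a * V a b -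
            ∑ b, targetDist T (trajRegret fb G p.1) b * ∑ a, p.2.1 a * V a b‖ ≤
          payoffBound V * explorationRate T := by
        intro p
        rw [← Finset.sum_sub_distrib, ← hsum, Finset.sum_mul]
        refine (Finset.abs_sum_le_sum_abs _ _).trans (Finset.sum_le_sum fun b _ => ?_)
        rw [← sub_mul, abs_mul, mul_comm]
        exact mul_le_mul (hbx p.2 b) (abs_playProb_sub_targetDist_le T _ b) (abs_nonneg _)
          (Finset.sum_nonneg fun a _ => abs_nonneg _)
      simpa using norm_integral_le_of_norm_le_const (Eventually.of_forall hb) (μ := ν)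
    rw [h1, h2, Finset.sum_range_succ, mul_add, add_sub_add_comm]
    exact (abs_add_le _ _).trans (add_le_add ih h3)

end Regret

/-! ### The Stackelberg value -/

section Stackelberg

variable {A₁ A₂ : Type*} [Fintype A₁] [Fintype A₂]

theorem continuous_sum_mul (f : A₁ → ℝ) : Continuous fun x : Mixed A₁ => ∑ a, x.1 a * f a :=
  continuous_finsetSum _ fun a _ =>
    ((continuous_apply a).comp continuous_subtype_val).mul continuous_const

/-- The payoffs that the first player can get by committing form a compact set. -/
theorem Game.isCompact_commitmentPayoffs (G : Game A₁ A₂) :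
    IsCompact {v | ∃ x : Mixed A₁, ∃ b ∈ G.bestResponse₂ x, v = ∑ a, x.1 a * G.U₁ a b} := by
  have : CompactSpace (Mixed A₁) := isCompact_iff_compactSpace.1 (isCompact_stdSimplex ℝ A₁)
  have h : {v | ∃ x : Mixed A₁, ∃ b ∈ G.bestResponse₂ x, v = ∑ a, x.1 a * G.U₁ a b} =
      ⋃ b, (fun x : Mixed A₁ => ∑ a, x.1 a * G.U₁ a b) '' {x | b ∈ G.bestResponse₂ x} := by
    ext v
    simp only [Set.mem_ofPred_eq, Set.mem_iUnion, Set.mem_image]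
    constructor
    · rintro ⟨x, b, hb, rfl⟩; exact ⟨b, x, hb, rfl⟩
    · rintro ⟨b, x, hb, rfl⟩; exact ⟨x, b, hb, rfl⟩
  rw [h]
  refine isCompact_iUnion fun b => IsCompact.image ?_ (continuous_sum_mul _)
  refine IsClosed.isCompact ?_
  have hset : {x : Mixed A₁ | b ∈ G.bestResponse₂ x} =
      ⋂ b', {x | ∑ a, x.1 a * G.U₂ a b' ≤ ∑ a, x.1 a * G.U₂ a b} := by
    ext x; simp [Game.bestResponse₂]
  rw [hset]
  exact isClosed_iInter fun b' =>
    isClosed_le (continuous_sum_mul fun a => G.U₂ a b') (continuous_sum_mul fun a => G.U₂ a b)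

theorem Game.le_stackVal₁ (G : Game A₁ A₂) (x : Mixed A₁) {b : A₂} (hb : b ∈ G.bestResponse₂ x) :
    ∑ a, x.1 a * G.U₁ a b ≤ G.stackVal₁ :=
  le_csSup G.isCompact_commitmentPayoffs.bddAbove ⟨x, b, hb, rfl⟩

theorem Game.exists_eq_stackVal₁ [Nonempty A₁] [Nonempty A₂] (G : Game A₁ A₂) :
    ∃ x : Mixed A₁, ∃ b ∈ G.bestResponse₂ x, G.stackVal₁ = ∑ a, x.1 a * G.U₁ a b := by
  refine G.isCompact_commitmentPayoffs.sSup_mem ?_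
  let x : Mixed A₁ := pureStrategy (Classical.arbitrary A₁)
  obtain ⟨b, hb⟩ := Finite.exists_max fun b => ∑ a, x.1 a * G.U₂ a b
  exact ⟨_, x, b, hb, rfl⟩

/-- An action that is not weakly dominated is the unique best response to some mixed strategy.
This is the theorem of the alternative: the payoff differences with the mixtures of the other
actions form a compact convex set that misses the nonnegative orthant, and the normal of a
separating hyperplane is the mixed strategy. -/
theorem Game.exists_unique_bestResponse₂ [Nonempty A₁] (G : Game A₁ A₂) {b : A₂}
    (hb : ¬ G.WeaklyDominated₂ b) :
    ∃ x : Mixed A₁, ∀ b', b' ≠ b → ∑ a, x.1 a * G.U₂ a b' < ∑ a, x.1 a * G.U₂ a b := by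
  classical
  by_cases hne : ∃ b', b' ≠ b
  swap
  · push Not at hne
    exact ⟨pureStrategy (Classical.arbitrary A₁), fun b' hb' => absurd (hne b') hb'⟩
  obtain ⟨b₁, hb₁⟩ := hne
  let L : (A₂ → ℝ) →ₗ[ℝ] (A₁ → ℝ) :=
    { toFun := fun y a => ∑ b', y b' * (G.U₂ a b' - G.U₂ a b)
      map_add' := fun y y' => by
        funext a; simp [add_mul, Finset.sum_add_distrib]
      map_smul' := fun r y => by
        funext a; simp [Finset.mul_sum, mul_assoc] }
  have hLc : Continuous L := by
    refine continuous_pi fun a => ?_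
    exact continuous_finsetSum _ fun b' _ => (continuous_apply b').mul continuous_const
  let S : Set (A₂ → ℝ) := stdSimplex ℝ A₂ ∩ {y | y b = 0}
  have hSconv : Convex ℝ S := by
    refine (convex_stdSimplex ℝ A₂).inter ?_
    intro y hy y' hy' r r' _ _ _
    simp only [Set.mem_ofPred_eq] at hy hy'
    simp [hy, hy']
  have hScomp : IsCompact S :=
    (isCompact_stdSimplex ℝ A₂).inter_right (isClosed_eq (continuous_apply b) continuous_const)
  have hdisj : Disjoint (L '' S) (Set.Ici (0 : A₁ → ℝ)) := by
    rw [Set.disjoint_left]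
    rintro _ ⟨y, ⟨hy, hyb⟩, rfl⟩ h0
    refine hb ⟨⟨y, hy⟩, hyb, fun a => ?_⟩
    have h : 0 ≤ ∑ b', y b' * (G.U₂ a b' - G.U₂ a b) := h0 a
    simp only [mul_sub, Finset.sum_sub_distrib] at h
    rw [← Finset.sum_mul, hy.2, one_mul] at h
    exact sub_nonneg.1 h
  obtain ⟨f, u, v, hfu, huv, hfv⟩ := geometric_hahn_banach_compact_closed
    (hSconv.linear_image L) (hScomp.image hLc) (convex_Ici 0) isClosed_Ici hdisj
  have hv0 : v < 0 := by simpa using hfv 0 (Set.mem_Ici.2 le_rfl)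
  set w : A₁ → ℝ := fun a => f (Pi.single a 1) with hw
  have hf : ∀ z : A₁ → ℝ, f z = ∑ a, z a * w a := by
    intro z
    conv_lhs => rw [pi_eq_sum_univ' z]
    rw [map_sum]
    refine Finset.sum_congr rfl fun a _ => ?_
    rw [map_smul, smul_eq_mul, hw]
  have hw0 : ∀ a, 0 ≤ w a := by
    intro a
    by_contra hneg
    push Not at hneg
    have h := hfv ((v / w a) • Pi.single a 1) (by
      intro i
      simp only [Pi.zero_apply, Pi.smul_apply, smul_eq_mul]
      refine mul_nonneg (div_nonneg_of_nonpos hv0.le hneg.le) ?_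
      by_cases hi : i = a
      · subst hi; simp
      · simp [hi])
    rw [map_smul, smul_eq_mul] at h
    change v < v / w a * w a at h
    rw [div_mul_cancel₀ _ hneg.ne] at h
    exact lt_irrefl _ h
  have hlt : ∀ b', b' ≠ b → ∑ a, (G.U₂ a b' - G.U₂ a b) * w a < 0 := by
    intro b' hb'
    have hmem : (pureStrategy b').1 ∈ S :=
      ⟨(pureStrategy b').2, by simp [pureStrategy, hb'.symm]⟩
    have h := (hfu _ ⟨_, hmem, rfl⟩).trans (huv.trans hv0)
    rw [hf] at h
    have hL : ∀ a, L (pureStrategy b').1 a = G.U₂ a b' - G.U₂ a b := fun a =>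
      sum_pureStrategy_mul b' fun c => G.U₂ a c - G.U₂ a b
    simpa only [hL] using h
  have hW : 0 < ∑ a, w a := by
    refine lt_of_le_of_ne (Finset.sum_nonneg fun a _ => hw0 a) fun h => ?_
    have hz : ∀ a, w a = 0 := fun a =>
      (Finset.sum_eq_zero_iff_of_nonneg fun a _ => hw0 a).1 h.symm a (Finset.mem_univ a)
    have := hlt b₁ hb₁
    simp [hz] at this
  refine ⟨⟨fun a => w a / ∑ a, w a, fun a => div_nonneg (hw0 a) hW.le, ?_⟩, fun b' hb' => ?_⟩
  · rw [← Finset.sum_div, div_self hW.ne']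
  · have h := hlt b' hb'
    have e : ∑ a, (G.U₂ a b' - G.U₂ a b) * w a =
        (∑ a, w a) * (∑ a, w a / (∑ a, w a) * G.U₂ a b' - ∑ a, w a / (∑ a, w a) * G.U₂ a b) := by
      rw [← Finset.sum_sub_distrib, Finset.mul_sum]
      refine Finset.sum_congr rfl fun a _ => ?_
      field_simp
    rw [e] at h
    exact sub_neg.1 ((pos_iff_neg_of_mul_neg h).1 hW)

/-- If the second player always best responds to the conditional strategy of the first player,
given her own action, then the first player gets at most the Stackelberg value. -/
theorem Game.sum_mul_le_stackVal₁ (G : Game A₁ A₂) {m : A₂ → A₁ → ℝ} (h0 : ∀ b a, 0 ≤ m b a)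
    (h1 : ∑ b, ∑ a, m b a = 1) (hbr : ∀ b b', ∑ a, m b a * (G.U₂ a b' - G.U₂ a b) ≤ 0) :
    ∑ b, ∑ a, m b a * G.U₁ a b ≤ G.stackVal₁ := by
  have key : ∀ b ∈ Finset.univ, ∑ a, m b a * G.U₁ a b ≤ (∑ a, m b a) * G.stackVal₁ := by
    intro b _
    rcases (Finset.sum_nonneg fun a _ => h0 b a).eq_or_lt with hw | hw
    · have hz : ∀ a, m b a = 0 := fun a =>
        (Finset.sum_eq_zero_iff_of_nonneg fun a _ => h0 b a).1 hw.symm a (Finset.mem_univ a)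
      simp [hz]
    · set w := ∑ a, m b a with hwdef
      let x : Mixed A₁ := ⟨fun a => m b a / w, fun a => div_nonneg (h0 b a) hw.le, by
        rw [← Finset.sum_div, div_self hw.ne']⟩
      have hx : ∀ V : A₁ → ℝ, ∑ a, m b a * V a = w * ∑ a, x.1 a * V a := by
        intro V
        rw [Finset.mul_sum]
        refine Finset.sum_congr rfl fun a _ => ?_
        change m b a * V a = w * (m b a / w * V a)
        field_simp
      have hmem : b ∈ G.bestResponse₂ x := by
        intro b'
        have h := hbr b b'
        rw [hx fun a => G.U₂ a b' - G.U₂ a b] at h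
        have := nonpos_of_mul_nonpos_right h hw
        simp only [mul_sub, Finset.sum_sub_distrib] at this
        linarith
      rw [hx]
      exact mul_le_mul_of_nonneg_left (G.le_stackVal₁ x hmem) hw.le
  refine (Finset.sum_le_sum key).trans_eq ?_
  rw [← Finset.sum_mul, h1, one_mul]

/-- The bound of `Game.sum_mul_le_stackVal₁` is stable: it holds in the limit for approximate best
responses, by compactness. -/
theorem Game.eventually_sum_mul_le (G : Game A₁ A₂) {m : ℕ → A₂ → A₁ → ℝ}
    (h0 : ∀ T b a, 0 ≤ m T b a) (h1 : ∀ᶠ T in atTop, ∑ b, ∑ a, m T b a = 1) {e : ℕ → ℝ}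
    (he : Tendsto e atTop (𝓝 0))
    (hbr : ∀ T b b', ∑ a, m T b a * (G.U₂ a b' - G.U₂ a b) ≤ e T) {η : ℝ} (hη : 0 < η) :
    ∀ᶠ T in atTop, ∑ b, ∑ a, m T b a * G.U₁ a b ≤ G.stackVal₁ + η := by
  by_contra hcon
  rw [Filter.not_eventually] at hcon
  obtain ⟨φ, hφ, hP⟩ := extraction_of_frequently_atTop (hcon.and_eventually h1)
  have hmem : ∀ n, m (φ n) ∈ Set.Icc (0 : A₂ → A₁ → ℝ) 1 := by
    refine fun n => ⟨fun b a => h0 _ b a, fun b a => ?_⟩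
    rw [Pi.one_apply, Pi.one_apply, ← (hP n).2]
    exact (Finset.single_le_sum (f := fun a => m (φ n) b a) (fun a _ => h0 _ b a)
      (Finset.mem_univ a)).trans (Finset.single_le_sum (f := fun b => ∑ a, m (φ n) b a)
      (fun b _ => Finset.sum_nonneg fun a _ => h0 _ b a) (Finset.mem_univ b))
  obtain ⟨m', _, ψ, hψ, hlim⟩ := isCompact_Icc.tendsto_subseq hmem
  have hl : ∀ b a, Tendsto (fun n => m (φ (ψ n)) b a) atTop (𝓝 (m' b a)) := fun b a =>
    tendsto_pi_nhds.1 (tendsto_pi_nhds.1 hlim b) a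
  have hφψ : Tendsto (fun n => φ (ψ n)) atTop atTop := (hφ.comp hψ).tendsto_atTop
  have hle := G.sum_mul_le_stackVal₁ (m := m')
    (fun b a => ge_of_tendsto' (hl b a) fun n => h0 _ b a)
    (tendsto_nhds_unique
      (tendsto_finsetSum _ fun b _ => tendsto_finsetSum _ fun a _ => hl b a)
      (tendsto_const_nhds.congr fun n => (hP (ψ n)).2.symm))
    (fun b b' => le_of_tendsto_of_tendsto'
      (tendsto_finsetSum _ fun a _ => (hl b a).mul_const _) (he.comp hφψ)
      fun n => hbr _ b b')
  have hge : G.stackVal₁ + η ≤ ∑ b, ∑ a, m' b a * G.U₁ a b :=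
    ge_of_tendsto' (tendsto_finsetSum _ fun b _ => tendsto_finsetSum _ fun a _ =>
      (hl b a).mul_const _) fun n => (not_le.1 (hP (ψ n)).1).le
  linarith

end Stackelberg

/-! ### Rates -/

theorem tendsto_inv_mul_rpow {α : ℝ} (hα : α < 1) :
    Tendsto (fun T : ℕ => 1 / (T : ℝ) * (T : ℝ) ^ α) atTop (𝓝 0) := by
  have h := (tendsto_rpow_neg_atTop (sub_pos.2 hα)).comp (tendsto_natCast_atTop_atTop (R := ℝ))
  refine h.congr' ?_
  filter_upwards [eventually_gt_atTop 0] with T hT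
  have hT' : (0 : ℝ) < T := by exact_mod_cast hT
  simp only [Function.comp_apply]
  rw [one_div, ← Real.rpow_neg_one, ← Real.rpow_add hT']
  congr 1
  ring

theorem tendsto_add_one_rpow_neg {α : ℝ} (hα : 0 < α) :
    Tendsto (fun t : ℕ => ((t : ℝ) + 1) ^ (-α)) atTop (𝓝 0) :=
  (tendsto_rpow_neg_atTop hα).comp
    (tendsto_atTop_add_const_right _ 1 tendsto_natCast_atTop_atTop)

theorem tendsto_inv_mul_sum_range {u : ℕ → ℝ} {l : ℝ} (hu : Tendsto u atTop (𝓝 l)) :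
    Tendsto (fun T : ℕ => 1 / (T : ℝ) * ∑ t ∈ Finset.range T, u t) atTop (𝓝 l) := by
  simpa only [one_div] using hu.cesaro

theorem tendsto_inv_mul_sum_explorationRate :
    Tendsto (fun T : ℕ => 1 / (T : ℝ) * ∑ t ∈ Finset.range T, explorationRate t) atTop (𝓝 0) :=
  tendsto_inv_mul_sum_range (tendsto_add_one_rpow_neg (by norm_num))

section Play

variable {A₁ A₂ : Type*} [Fintype A₁] [Fintype A₂] {fb : Feedback} {I : Type*}

/-! ### The first player against the learner -/

/-- Average payoffs against the learner are averages of the occupation weights in the limit. -/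
theorem tendsto_average_sub_occupation [Nonempty A₂] (π₁ : Algorithm fb I A₁ A₂)
    (G : Game A₁ A₂) (s₁ s₂ : I) (V : A₁ → A₂ → ℝ) :
    Tendsto (fun T : ℕ => 1 / (T : ℝ) * ∫ h, ∑ t, mixedPayoff V (h t).1 (h t).2
        ∂(trajectoryLaw π₁ (learner fb I A₂ A₁) G s₁ s₂ T) -
      1 / (T : ℝ) * ∑ b, ∑ a, occupation π₁ G s₁ s₂ T b a * V a b) atTop (𝓝 0) := by
  have h := tendsto_inv_mul_sum_explorationRate.const_mul (payoffBound V)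
  rw [mul_zero] at h
  refine squeeze_zero_norm (fun T => ?_) h
  rw [← mul_sub, norm_mul, Real.norm_eq_abs, Real.norm_eq_abs, abs_of_nonneg (by positivity)]
  calc _ ≤ 1 / (T : ℝ) * (payoffBound V * ∑ t ∈ Finset.range T, explorationRate t) :=
        mul_le_mul_of_nonneg_left (abs_integral_sum_sub_le π₁ G s₁ s₂ T V) (by positivity)
    _ = _ := by ring

/-- No algorithm of the first player gets more than the Stackelberg value from the learner. -/
theorem eventually_average_le_stackVal₁ [Nonempty A₂] (π₁ : Algorithm fb I A₁ A₂)
    (G : Game A₁ A₂) (s₁ s₂ : I) {η : ℝ} (hη : 0 < η) :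
    ∀ᶠ T : ℕ in atTop, 1 / (T : ℝ) * ∫ h, ∑ t, mixedPayoff G.U₁ (h t).1 (h t).2
      ∂(trajectoryLaw π₁ (learner fb I A₂ A₁) G s₁ s₂ T) ≤ G.stackVal₁ + η := by
  set K := growthConst (Fintype.card A₂) (payoffBound G.U₂) + 2 with hK
  have he : Tendsto (fun T : ℕ => K * (1 / (T : ℝ) * (T : ℝ) ^ (3 / 4 : ℝ))) atTop (𝓝 0) := by
    simpa using (tendsto_inv_mul_rpow (α := 3 / 4) (by norm_num)).const_mul K
  have h1 := G.eventually_sum_mul_le (m := fun T b a => 1 / (T : ℝ) * occupation π₁ G s₁ s₂ T b a)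
    (fun T b a => mul_nonneg (by positivity) (occupation_nonneg π₁ G s₁ s₂ T b a))
    (by
      filter_upwards [eventually_gt_atTop 0] with T hT
      have hT' : (T : ℝ) ≠ 0 := by positivity
      simp only [← Finset.mul_sum]
      rw [sum_occupation]
      field_simp) he
    (fun T b b' => by
      simp only [mul_assoc, ← Finset.mul_sum]
      have := mul_le_mul_of_nonneg_left (sum_occupation_mul_sub_le π₁ G s₁ s₂ T b b')
        (show 0 ≤ 1 / (T : ℝ) by positivity)
      rw [← hK] at this
      linarith) (half_pos hη)
  have h2 := (tendsto_average_sub_occupation π₁ G s₁ s₂ G.U₁).eventually_lt_const (half_pos hη)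
  filter_upwards [h1, h2] with T h1 h2
  simp only [mul_assoc, ← Finset.mul_sum] at h1
  linarith

/-! ### Commitment to a path of mixed strategies -/

/-- The algorithm that plays, in round `t` and with signal `s`, the mixed strategy `x s t`
whatever the feedback is. -/
def commitAlgorithm {A B : Type*} [Fintype A] [Fintype B] (fb : Feedback) (x : I → ℕ → Mixed A) :
    Algorithm fb I A B where
  kernel s t := Kernel.const _ (Measure.dirac (x s t))
  markov _ _ := inferInstance

/-- A bound on the payoffs in each round against a committed opponent adds up. -/
theorem integral_commitAlgorithm_le (x : I → ℕ → Mixed A₁) (π₂ : Algorithm fb I A₂ A₁)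
    (G : Game A₁ A₂) (s₁ s₂ : I) (V : A₁ → A₂ → ℝ) {c : ℕ → ℝ}
    (hc : ∀ t y, mixedPayoff V (x s₁ t) y ≤ c t) (T : ℕ) :
    ∫ h, ∑ t, mixedPayoff V (h t).1 (h t).2
      ∂(trajectoryLaw (commitAlgorithm fb x) π₂ G s₁ s₂ T) ≤ ∑ t ∈ Finset.range T, c t := by
  induction T with
  | zero => simp
  | succ T ih =>
    have := π₂.markov s₂ T
    have := (commitAlgorithm (B := A₂) fb x).markov s₁ T
    set μ := trajectoryLaw (commitAlgorithm fb x) π₂ G s₁ s₂ T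
    set κ := roundKernel (commitAlgorithm fb x) π₂ G s₁ s₂ T with hκ
    have hint : Integrable (fun z : Trajectory A₁ A₂ T × (Mixed A₁ × Mixed A₂) =>
        ∑ t, mixedPayoff V (z.1 t).1 (z.1 t).2 + mixedPayoff V z.2.1 z.2.2) (μ ⊗ₘ κ) :=
      (integrable_of_abs_le ((measurable_sum_mixedPayoff V T).comp measurable_fst)
        fun z => abs_sum_mixedPayoff_le V z.1).add
      (integrable_of_abs_le ((measurable_mixedPayoff V).comp measurable_snd)
        fun z => abs_mixedPayoff_le V z.2.1 z.2.2)
    have hS : Integrable (fun h : Trajectory A₁ A₂ T => ∑ t, mixedPayoff V (h t).1 (h t).2) μ :=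
      integrable_of_abs_le (measurable_sum_mixedPayoff V T) (abs_sum_mixedPayoff_le V)
    have hV : ∀ h, Integrable (fun z : Mixed A₁ × Mixed A₂ => mixedPayoff V z.1 z.2) (κ h) :=
      fun h => integrable_of_abs_le (measurable_mixedPayoff V) fun z => abs_mixedPayoff_le V _ _
    have hround : ∀ h, ∫ z, mixedPayoff V z.1 z.2 ∂(κ h) ≤ c T := by
      intro h
      have hm : Measurable fun y : Mixed A₂ => mixedPayoff V (x s₁ T) y :=
        Measurable.comp (g := fun z : Mixed A₁ × Mixed A₂ => mixedPayoff V z.1 z.2)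
          (f := fun y => (x s₁ T, y)) (measurable_mixedPayoff V) measurable_prodMk_left
      have e : κ h = (Measure.dirac (x s₁ T)).prod (π₂.kernel s₂ T (history₂ fb G h)) := by
        rw [hκ, roundKernel, Kernel.prod_apply]
        rfl
      rw [e, Measure.dirac_prod, integral_map (by fun_prop)
        (measurable_mixedPayoff V).aestronglyMeasurable]
      refine (integral_mono (integrable_of_abs_le hm fun y => abs_mixedPayoff_le V _ _)
        (integrable_const (c T)) fun y => hc T y).trans_eq ?_
      simp
    rw [integral_trajectoryLaw_succ _ _ _ _ _ _ (measurable_sum_mixedPayoff V (T + 1))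
      (abs_sum_mixedPayoff_le V), Finset.sum_range_succ]
    simp only [sum_mixedPayoff_snoc]
    have hle : ∀ h : Trajectory A₁ A₂ T,
        ∫ z, (∑ t, mixedPayoff V (h t).1 (h t).2 + mixedPayoff V z.1 z.2) ∂(κ h) ≤
        ∑ t, mixedPayoff V (h t).1 (h t).2 + c T := by
      intro h
      rw [integral_add (integrable_const _) (hV h)]
      simpa using hround h
    have hinner : Integrable (fun h : Trajectory A₁ A₂ T =>
        ∫ z, (∑ t, mixedPayoff V (h t).1 (h t).2 + mixedPayoff V z.1 z.2) ∂(κ h)) μ :=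
      Integrable.integral_compProd (κ := Kernel.const Unit μ) (η := Kernel.prodMkLeft Unit κ)
        (a := ()) hint
    refine (integral_mono hinner (hS.add (integrable_const (c T))) hle).trans ?_
    rw [integral_add' hS (integrable_const _)]
    simpa using ih

variable [Nonempty A₂]

/-- The expected target distribution of the learner in round `t` against a committed opponent. -/
def meanTarget (x : I → ℕ → Mixed A₁) (fb : Feedback) (G : Game A₁ A₂) (s₁ s₂ : I) (t : ℕ)
    (b : A₂) : ℝ :=
  ∫ h, targetDist t (trajRegret fb G h) b
    ∂(trajectoryLaw (commitAlgorithm fb x) (learner fb I A₂ A₁) G s₁ s₂ t)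

theorem integrable_targetDist (x : I → ℕ → Mixed A₁) (fb : Feedback) (G : Game A₁ A₂) (s₁ s₂ : I)
    (t : ℕ) (b : A₂) : Integrable (fun h => targetDist t (trajRegret fb G h) b)
      (trajectoryLaw (commitAlgorithm fb x) (learner fb I A₂ A₁) G s₁ s₂ t) := by
  refine integrable_of_abs_le (C := 1)
    ((measurable_targetDist t b).comp (measurable_trajRegret fb G t)) fun h => ?_
  have hq := targetDist_mem_stdSimplex t (trajRegret fb G h)
  rw [abs_of_nonneg (hq.1 b)]
  exact le_one_of_mem_stdSimplex hq b

theorem meanTarget_mem_stdSimplex (x : I → ℕ → Mixed A₁) (fb : Feedback) (G : Game A₁ A₂)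
    (s₁ s₂ : I) (t : ℕ) : meanTarget x fb G s₁ s₂ t ∈ stdSimplex ℝ A₂ := by
  refine ⟨fun b => integral_nonneg fun h => (targetDist_mem_stdSimplex t _).1 b, ?_⟩
  unfold meanTarget
  rw [← integral_finsetSum _ fun b _ => integrable_targetDist x fb G s₁ s₂ t b]
  simp [(targetDist_mem_stdSimplex t _).2]

theorem occupation_commitAlgorithm (x : I → ℕ → Mixed A₁) (G : Game A₁ A₂) (s₁ s₂ : I) (T : ℕ)
    (b : A₂) (a : A₁) :
    occupation (commitAlgorithm fb x) G s₁ s₂ T b a =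
      ∑ t ∈ Finset.range T, meanTarget x fb G s₁ s₂ t b * (x s₁ t).1 a := by
  refine Finset.sum_congr rfl fun t _ => ?_
  have := (commitAlgorithm (B := A₂) fb x).markov s₁ t
  have hint := integrable_targetDist_mul (commitAlgorithm fb x) G s₁ s₂ t b a
  unfold nextLaw at hint ⊢
  rw [Measure.integral_compProd hint, meanTarget, ← integral_mul_const]
  refine integral_congr_ae (Eventually.of_forall fun h => ?_)
  have hm : Measurable fun y : Mixed A₁ => targetDist t (trajRegret fb G h) b * y.1 a :=
    ((measurable_pi_apply a).comp measurable_subtype_coe).const_mul _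
  exact integral_dirac' _ _ hm.stronglyMeasurable

theorem sum_occupation_commitAlgorithm_mul (x : I → ℕ → Mixed A₁) (G : Game A₁ A₂) (s₁ s₂ : I)
    (T : ℕ) (b : A₂) (V : A₁ → ℝ) :
    ∑ a, occupation (commitAlgorithm fb x) G s₁ s₂ T b a * V a =
      ∑ t ∈ Finset.range T, meanTarget x fb G s₁ s₂ t b * ∑ a, (x s₁ t).1 a * V a := by
  simp only [occupation_commitAlgorithm, Finset.sum_mul, Finset.mul_sum]
  rw [Finset.sum_comm]
  simp only [mul_assoc]

/-- Suppose that the first player commits to a path along which `b₀` beats every other response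
by a margin that vanishes slowly enough. Then the learner aims at the other actions in a vanishing
fraction of the rounds. -/
theorem tendsto_average_meanTarget (x : I → ℕ → Mixed A₁) (fb : Feedback) (G : Game A₁ A₂)
    (s₁ s₂ : I) {b₀ b : A₂} {c : ℝ} (hc : 0 < c)
    (hgap : ∀ t : ℕ, c * ((t : ℝ) + 1) ^ (-(1 / 8) : ℝ) ≤
      ∑ a, (x s₁ t).1 a * (G.U₂ a b₀ - G.U₂ a b)) :
    Tendsto (fun T : ℕ => 1 / (T : ℝ) * ∑ t ∈ Finset.range T, meanTarget x fb G s₁ s₂ t b)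
      atTop (𝓝 0) := by
  set K := growthConst (Fintype.card A₂) (payoffBound G.U₂) + 2 with hK
  have hlim : Tendsto (fun T : ℕ => K / c * (1 / (T : ℝ) * (T : ℝ) ^ (7 / 8 : ℝ))) atTop (𝓝 0) := by
    simpa using (tendsto_inv_mul_rpow (α := 7 / 8) (by norm_num)).const_mul (K / c)
  have hq := fun t => (meanTarget_mem_stdSimplex x fb G s₁ s₂ t).1 b
  refine tendsto_of_tendsto_of_tendsto_of_le_of_le' tendsto_const_nhds hlim
    (Eventually.of_forall fun T => mul_nonneg (by positivity) (Finset.sum_nonneg fun t _ => hq t))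
    ?_
  filter_upwards [eventually_gt_atTop 0] with T hT
  have hT' : (0 : ℝ) < T := by exact_mod_cast hT
  have h1 := sum_occupation_mul_sub_le (commitAlgorithm fb x) G s₁ s₂ T b b₀
  rw [sum_occupation_commitAlgorithm_mul (fb := fb) x G s₁ s₂ T b
    fun a => G.U₂ a b₀ - G.U₂ a b, ← hK] at h1
  have h2 : (c * (T : ℝ) ^ (-(1 / 8) : ℝ)) * ∑ t ∈ Finset.range T, meanTarget x fb G s₁ s₂ t b ≤
      ∑ t ∈ Finset.range T, meanTarget x fb G s₁ s₂ t b *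
        ∑ a, (x s₁ t).1 a * (G.U₂ a b₀ - G.U₂ a b) := by
    rw [Finset.mul_sum]
    refine Finset.sum_le_sum fun t ht => ?_
    rw [mul_comm]
    refine mul_le_mul_of_nonneg_left (le_trans ?_ (hgap t)) (hq t)
    refine mul_le_mul_of_nonneg_left ?_ hc.le
    exact Real.rpow_le_rpow_of_nonpos (by positivity)
      (by exact_mod_cast Finset.mem_range.1 ht) (by norm_num)
  have h3 : (T : ℝ) ^ (7 / 8 : ℝ) * (T : ℝ) ^ (-(1 / 8) : ℝ) = (T : ℝ) ^ (3 / 4 : ℝ) := by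
    rw [← Real.rpow_add hT']; norm_num
  have h4 : ∑ t ∈ Finset.range T, meanTarget x fb G s₁ s₂ t b ≤
      K / c * (T : ℝ) ^ (7 / 8 : ℝ) := by
    have hr : 0 < (T : ℝ) ^ (-(1 / 8) : ℝ) := Real.rpow_pos_of_pos hT' _
    refine le_of_mul_le_mul_left ((h2.trans h1).trans_eq ?_) (mul_pos hc hr)
    rw [← h3]
    field_simp
  have := mul_le_mul_of_nonneg_left h4 (show 0 ≤ 1 / (T : ℝ) by positivity)
  linarith

/-- In the situation of `tendsto_average_meanTarget`, average payoffs converge to the payoff of the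
limit of the path against `b₀`. -/
theorem tendsto_average_commitAlgorithm (x : I → ℕ → Mixed A₁) (G : Game A₁ A₂) (s₁ s₂ : I)
    {x₀ : Mixed A₁} {b₀ : A₂} {c : ℝ} (hc : 0 < c)
    (hgap : ∀ b, b ≠ b₀ → ∀ t : ℕ, c * ((t : ℝ) + 1) ^ (-(1 / 8) : ℝ) ≤
      ∑ a, (x s₁ t).1 a * (G.U₂ a b₀ - G.U₂ a b))
    (hx : ∀ a, Tendsto (fun t => (x s₁ t).1 a) atTop (𝓝 (x₀.1 a))) (V : A₁ → A₂ → ℝ) :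
    Tendsto (fun T : ℕ => 1 / (T : ℝ) * ∫ h, ∑ t, mixedPayoff V (h t).1 (h t).2
        ∂(trajectoryLaw (commitAlgorithm fb x) (learner fb I A₂ A₁) G s₁ s₂ T)) atTop
      (𝓝 (∑ a, x₀.1 a * V a b₀)) := by
  have hcesaro := tendsto_inv_mul_sum_range
    (tendsto_finsetSum Finset.univ fun a _ => (hx a).mul_const (V a b₀))
  have hbound : ∀ t b, |∑ a, (x s₁ t).1 a * V a b| ≤ payoffBound V := fun t b => by
    rw [← mixedPayoff_pureStrategy]; exact abs_mixedPayoff_le V _ _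
  have hother : ∀ b, Tendsto (fun T : ℕ => 1 / (T : ℝ) * ∑ t ∈ Finset.range T,
      meanTarget x fb G s₁ s₂ t b *
        (∑ a, (x s₁ t).1 a * V a b - ∑ a, (x s₁ t).1 a * V a b₀)) atTop (𝓝 0) := by
    intro b
    by_cases hb : b = b₀
    · subst hb; simp
    have h := (tendsto_average_meanTarget x fb G s₁ s₂ hc (hgap b hb)).const_mul
      (2 * payoffBound V)
    rw [mul_zero] at h
    refine squeeze_zero_norm (fun T => ?_) h
    rw [norm_mul, Real.norm_eq_abs, abs_of_nonneg (by positivity), mul_left_comm]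
    refine mul_le_mul_of_nonneg_left ?_ (by positivity)
    rw [Finset.mul_sum]
    refine (norm_sum_le _ _).trans (Finset.sum_le_sum fun t _ => ?_)
    rw [norm_mul, Real.norm_eq_abs, Real.norm_eq_abs,
      abs_of_nonneg ((meanTarget_mem_stdSimplex x fb G s₁ s₂ t).1 b), mul_comm]
    refine mul_le_mul_of_nonneg_right ?_ ((meanTarget_mem_stdSimplex x fb G s₁ s₂ t).1 b)
    have := abs_sub (∑ a, (x s₁ t).1 a * V a b) (∑ a, (x s₁ t).1 a * V a b₀)
    linarith [hbound t b, hbound t b₀]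
  have hocc : ∀ T : ℕ, 1 / (T : ℝ) * ∑ b, ∑ a,
      occupation (commitAlgorithm fb x) G s₁ s₂ T b a * V a b =
      1 / (T : ℝ) * ∑ t ∈ Finset.range T, ∑ a, (x s₁ t).1 a * V a b₀ +
      ∑ b, 1 / (T : ℝ) * ∑ t ∈ Finset.range T, meanTarget x fb G s₁ s₂ t b *
        (∑ a, (x s₁ t).1 a * V a b - ∑ a, (x s₁ t).1 a * V a b₀) := by
    intro T
    simp only [fun b => sum_occupation_commitAlgorithm_mul (fb := fb) x G s₁ s₂ T b fun a => V a b]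
    rw [← Finset.mul_sum, ← mul_add]
    congr 1
    rw [Finset.sum_comm, Finset.sum_comm (s := Finset.univ), ← Finset.sum_add_distrib]
    refine Finset.sum_congr rfl fun t _ => ?_
    simp only [mul_sub, Finset.sum_sub_distrib]
    rw [← Finset.sum_mul, (meanTarget_mem_stdSimplex x fb G s₁ s₂ t).2]
    ring
  have h := (tendsto_average_sub_occupation (commitAlgorithm fb x) G s₁ s₂ V).add
    (hcesaro.add (tendsto_finsetSum Finset.univ fun b _ => hother b))
  simp only [← hocc, sub_add_cancel, Finset.sum_const_zero, add_zero, zero_add] at h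
  exact h

end Play

/-! ### Paths that lead to the Stackelberg commitment -/

section Path

variable {A₁ A₂ : Type*} [Fintype A₁] [Fintype A₂]

/-- A path of mixed strategies that approaches an optimal commitment `x₀`, to which `b₀` is the
favourable best response, in such a way that `b₀` is the unique best response all along, by a
margin that vanishes slowly. -/
structure Game.IsStackelbergPath (G : Game A₁ A₂) (x : ℕ → Mixed A₁) (x₀ : Mixed A₁) (b₀ : A₂)
    (c : ℝ) : Prop where
  pos : 0 < c
  eq_stackVal₁ : ∑ a, x₀.1 a * G.U₁ a b₀ = G.stackVal₁
  gap : ∀ b, b ≠ b₀ → ∀ t : ℕ, c * ((t : ℝ) + 1) ^ (-(1 / 8) : ℝ) ≤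
    ∑ a, (x t).1 a * (G.U₂ a b₀ - G.U₂ a b)
  tendsto : ∀ a, Tendsto (fun t => (x t).1 a) atTop (𝓝 (x₀.1 a))

/-- The path mixes an optimal commitment with a strategy that makes `b₀` the unique best response,
with vanishing weight on the latter. -/
theorem Game.NoWeaklyDominatedAction.exists_isStackelbergPath [Nonempty A₁] [Nonempty A₂]
    {G : Game A₁ A₂} (hG : G.NoWeaklyDominatedAction) :
    ∃ x x₀ b₀ c, G.IsStackelbergPath x x₀ b₀ c := by
  classical
  obtain ⟨x₀, b₀, hb₀, hval⟩ := G.exists_eq_stackVal₁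
  obtain ⟨x', hx'⟩ := G.exists_unique_bestResponse₂ (hG.2 b₀)
  set gap : A₂ → ℝ := fun b => ∑ a, x'.1 a * G.U₂ a b₀ - ∑ a, x'.1 a * G.U₂ a b with hgap
  obtain ⟨c, hc, hcgap⟩ : ∃ c, 0 < c ∧ ∀ b, b ≠ b₀ → c ≤ gap b := by
    rcases (Finset.univ.erase b₀).eq_empty_or_nonempty with h | h
    · refine ⟨1, one_pos, fun b hb => ?_⟩
      have : b ∈ Finset.univ.erase b₀ := by simp [hb]
      simp [h] at this
    · obtain ⟨b₁, hb₁, hmin⟩ := Finset.exists_min_image _ gap h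
      exact ⟨gap b₁, sub_pos.2 (hx' b₁ (Finset.ne_of_mem_erase hb₁)),
        fun b hb => hmin b (by simp [hb])⟩
  set δ : ℕ → ℝ := fun t => ((t : ℝ) + 1) ^ (-(1 / 8) : ℝ) with hδ
  have hδ0 : ∀ t, 0 ≤ δ t := fun t => by positivity
  have hδ1 : ∀ t, δ t ≤ 1 := fun t =>
    Real.rpow_le_one_of_one_le_of_nonpos (by linarith [Nat.cast_nonneg (α := ℝ) t]) (by norm_num)
  have hδlim : Tendsto δ atTop (𝓝 0) := tendsto_add_one_rpow_neg (by norm_num)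
  let x : ℕ → Mixed A₁ := fun t => ⟨(1 - δ t) • x₀.1 + δ t • x'.1,
    convex_stdSimplex ℝ A₁ x₀.2 x'.2 (sub_nonneg.2 (hδ1 t)) (hδ0 t) (by ring)⟩
  have hxa : ∀ t a, (x t).1 a = (1 - δ t) * x₀.1 a + δ t * x'.1 a := fun t a => rfl
  refine ⟨x, x₀, b₀, c, hc, hval.symm, fun b hb t => ?_, fun a => ?_⟩
  · have e : ∑ a, (x t).1 a * (G.U₂ a b₀ - G.U₂ a b) =
        (1 - δ t) * (∑ a, x₀.1 a * G.U₂ a b₀ - ∑ a, x₀.1 a * G.U₂ a b) + δ t * gap b := by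
      simp only [hgap, hxa, ← Finset.sum_sub_distrib, Finset.mul_sum, ← Finset.sum_add_distrib]
      exact Finset.sum_congr rfl fun a _ => by ring
    rw [e]
    have h1 := mul_nonneg (sub_nonneg.2 (hδ1 t)) (sub_nonneg.2 (hb₀ b))
    have h2 := mul_le_mul_of_nonneg_left (hcgap b hb) (hδ0 t)
    change c * δ t ≤ _
    linarith
  · have h := (((hδlim.const_sub 1).mul_const (x₀.1 a)).add (hδlim.mul_const (x'.1 a)))
    simp only [sub_zero, one_mul, zero_mul, add_zero] at h
    exact h

/-- Along the path, `b₀` is a best response in every round. -/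
theorem Game.IsStackelbergPath.mixedPayoff_le {G : Game A₁ A₂} {x : ℕ → Mixed A₁} {x₀ : Mixed A₁}
    {b₀ : A₂} {c : ℝ} (h : G.IsStackelbergPath x x₀ b₀ c) (t : ℕ) (y : Mixed A₂) :
    mixedPayoff G.U₂ (x t) y ≤ ∑ a, (x t).1 a * G.U₂ a b₀ := by
  have key : ∀ b ∈ Finset.univ, y.1 b * ∑ a, (x t).1 a * G.U₂ a b ≤
      y.1 b * ∑ a, (x t).1 a * G.U₂ a b₀ := by
    intro b _
    refine mul_le_mul_of_nonneg_left ?_ (y.2.1 b)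
    by_cases hb : b = b₀
    · rw [hb]
    have h1 := h.gap b hb t
    have h2 : 0 ≤ c * ((t : ℝ) + 1) ^ (-(1 / 8) : ℝ) := mul_nonneg h.pos.le (by positivity)
    simp only [mul_sub, Finset.sum_sub_distrib] at h1
    linarith
  rw [mixedPayoff_eq_sum]
  refine (Finset.sum_le_sum key).trans_eq ?_
  rw [← Finset.sum_mul, y.2.2, one_mul]

end Path

/-! ### Averages over signals and over the prior -/

section Prior

variable {A₁ A₂ : Type*} [Fintype A₁] [Fintype A₂] {fb : Feedback} {I : Type*}

theorem signalUtility₁_eq (π₁ : Algorithm fb I A₁ A₂) (π₂ : Algorithm fb I A₂ A₁)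
    (G : Game A₁ A₂) (s₁ s₂ : I) (T : ℕ) :
    signalUtility₁ π₁ π₂ G s₁ s₂ T = 1 / (T : ℝ) * ∫ h, ∑ t, mixedPayoff G.U₁ (h t).1 (h t).2
      ∂(trajectoryLaw π₁ π₂ G s₁ s₂ T) :=
  integral_const_mul _ _

theorem signalUtility₂_eq (π₁ : Algorithm fb I A₁ A₂) (π₂ : Algorithm fb I A₂ A₁)
    (G : Game A₁ A₂) (s₁ s₂ : I) (T : ℕ) :
    signalUtility₂ π₁ π₂ G s₁ s₂ T = 1 / (T : ℝ) * ∫ h, ∑ t, mixedPayoff G.U₂ (h t).1 (h t).2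
      ∂(trajectoryLaw π₁ π₂ G s₁ s₂ T) :=
  integral_const_mul _ _

theorem abs_average_le (π₁ : Algorithm fb I A₁ A₂) (π₂ : Algorithm fb I A₂ A₁)
    (G : Game A₁ A₂) (s₁ s₂ : I) (T : ℕ) (V : A₁ → A₂ → ℝ) :
    |1 / (T : ℝ) * ∫ h, ∑ t, mixedPayoff V (h t).1 (h t).2
      ∂(trajectoryLaw π₁ π₂ G s₁ s₂ T)| ≤ payoffBound V := by
  rcases Nat.eq_zero_or_pos T with rfl | hT
  · simpa using payoffBound_nonneg V
  have hT' : (0 : ℝ) < T := by exact_mod_cast hT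
  have h := norm_integral_le_of_norm_le_const (μ := trajectoryLaw π₁ π₂ G s₁ s₂ T)
    (f := fun h : Trajectory A₁ A₂ T => ∑ t, mixedPayoff V (h t).1 (h t).2)
    (Eventually.of_forall fun h => abs_sum_mixedPayoff_le V h)
  rw [probReal_univ, mul_one, Real.norm_eq_abs] at h
  rw [abs_mul, abs_of_pos (by positivity), one_div, inv_mul_le_iff₀ hT']
  exact h

theorem summable_pmf_toReal {ι : Type*} (D : PMF ι) : Summable fun s => (D s).toReal :=
  ENNReal.summable_toReal D.tsum_coe_ne_top

theorem signalProb_nonneg (D : PMF I) {p : ℝ} (hp : 0 ≤ p) (hp' : p ≤ 1) (G s : I) :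
    0 ≤ signalProb D p G s := by
  unfold signalProb
  have : 0 ≤ 1 - p := by linarith
  split_ifs <;> positivity

theorem hasSum_signalProb (D : PMF I) (p : ℝ) (G : I) : HasSum (signalProb D p G) 1 := by
  classical
  have h1 : HasSum (fun s => if s = G then (1 : ℝ) else 0) 1 := by
    simpa using hasSum_ite_eq G (1 : ℝ)
  have h2 : HasSum (fun s => (D s).toReal) 1 := by
    have h := (summable_pmf_toReal D).hasSum
    rwa [← ENNReal.tsum_toReal_eq fun s => D.apply_ne_top s, D.tsum_coe, ENNReal.toReal_one] at h
  have h := (h1.mul_left p).add (h2.mul_left (1 - p))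
  have e : p * 1 + (1 - p) * 1 = 1 := by ring
  rw [e] at h
  refine h.congr_fun fun s => ?_
  unfold signalProb
  congr

/-- Averaging over the signals when the first player's signal is the realized game. -/
theorem tsum_signalProb_one (D : PMF I) (p₂ : ℝ) (G : I) (f : I → I → ℝ) :
    ∑' s₁, ∑' s₂, signalProb D 1 G s₁ * signalProb D p₂ G s₂ * f s₁ s₂ =
      ∑' s₂, signalProb D p₂ G s₂ * f G s₂ := by
  rw [tsum_eq_single G]
  · simp [signalProb]
  · intro s hs
    simp [signalProb, hs]

theorem tsum_signalProb_mul_const (D : PMF I) (p : ℝ) (G : I) (r : ℝ) :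
    ∑' s, signalProb D p G s * r = r := by
  rw [tsum_mul_right, (hasSum_signalProb D p G).tsum_eq, one_mul]

theorem abs_tsum_signalProb_mul_le (D : PMF I) {p : ℝ} (hp : 0 ≤ p) (hp' : p ≤ 1) (G : I)
    {f : I → ℝ} {B : ℝ} (hf : ∀ s, |f s| ≤ B) : |∑' s, signalProb D p G s * f s| ≤ B := by
  have h := (hasSum_signalProb D p G).mul_right B
  rw [one_mul] at h
  rw [← Real.norm_eq_abs]
  refine tsum_of_norm_bounded h fun s => ?_
  rw [norm_mul, Real.norm_eq_abs, abs_of_nonneg (signalProb_nonneg D hp hp' G s)]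
  exact mul_le_mul_of_nonneg_left (hf s) (signalProb_nonneg D hp hp' G s)

theorem tsum_signalProb_mul_le (D : PMF I) {p : ℝ} (hp : 0 ≤ p) (hp' : p ≤ 1) (G : I)
    {f : I → ℝ} {B r : ℝ} (hf : ∀ s, |f s| ≤ B) (hr : ∀ s, f s ≤ r) :
    ∑' s, signalProb D p G s * f s ≤ r := by
  have hs := (hasSum_signalProb D p G).summable
  have hsf : Summable fun s => signalProb D p G s * f s := by
    refine Summable.of_norm_bounded (hs.mul_right B) fun s => ?_
    rw [norm_mul, Real.norm_eq_abs, abs_of_nonneg (signalProb_nonneg D hp hp' G s)]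
    exact mul_le_mul_of_nonneg_left (hf s) (signalProb_nonneg D hp hp' G s)
  rw [← tsum_signalProb_mul_const D p G r]
  exact hsf.tsum_le_tsum
    (fun s => mul_le_mul_of_nonneg_left (hr s) (signalProb_nonneg D hp hp' G s)) (hs.mul_right r)

/-- By dominated convergence, a gain that vanishes in the limit for every game in the support
vanishes in the limit on average. -/
theorem limsup_tsum_sub_tsum_le {ι : Type*} (D : PMF ι) {f g : ℕ → ι → ℝ} {B : ι → ℝ}
    (hB : Summable fun G => (D G).toReal * B G) (hf : ∀ T G, |f T G| ≤ B G)
    (hg : ∀ T G, |g T G| ≤ B G)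
    (h : ∀ G ∈ D.support, ∀ η, 0 < η → ∀ᶠ T in atTop, f T G - g T G ≤ η) :
    limsup (fun T : ℕ =>
      ((∑' G, (D G).toReal * f T G - ∑' G, (D G).toReal * g T G : ℝ) : EReal)) atTop ≤ 0 := by
  have hsum : ∀ {u : ℕ → ι → ℝ}, (∀ T G, |u T G| ≤ B G) → ∀ T,
      Summable fun G => (D G).toReal * u T G := by
    intro u hu T
    refine Summable.of_norm_bounded hB fun G => ?_
    rw [norm_mul, Real.norm_eq_abs, abs_of_nonneg ENNReal.toReal_nonneg]
    exact mul_le_mul_of_nonneg_left (hu T G) ENNReal.toReal_nonneg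
  have hbound : ∀ T G, ‖(D G).toReal * max (f T G - g T G) 0‖ ≤ 2 * ((D G).toReal * B G) := by
    intro T G
    rw [norm_mul, Real.norm_eq_abs, Real.norm_eq_abs, abs_of_nonneg ENNReal.toReal_nonneg,
      abs_of_nonneg (le_max_right _ _), mul_left_comm]
    refine mul_le_mul_of_nonneg_left (max_le ?_ ?_) ENNReal.toReal_nonneg
    · have h1 := abs_le.1 (hf T G)
      have h2 := abs_le.1 (hg T G)
      linarith
    · have := (abs_nonneg _).trans (hf T G)
      linarith
  have hlim : Tendsto (fun T => ∑' G, (D G).toReal * max (f T G - g T G) 0) atTop (𝓝 0) := by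
    have hpt : ∀ G, Tendsto (fun T => (D G).toReal * max (f T G - g T G) 0) atTop (𝓝 0) := by
      intro G
      by_cases hG : G ∈ D.support
      · have hmax : Tendsto (fun T => max (f T G - g T G) 0) atTop (𝓝 0) := by
          refine tendsto_order.2 ⟨fun a ha => Eventually.of_forall fun T =>
            ha.trans_le (le_max_right _ _), fun a ha => ?_⟩
          filter_upwards [h G hG (a / 2) (half_pos ha)] with T hT
          exact max_lt (by linarith) ha
        simpa using hmax.const_mul (D G).toReal
      · have : D G = 0 := by simpa [PMF.mem_support_iff] using hG
        simp [this]
    simpa using tendsto_tsum_of_dominated_convergence (hB.mul_left 2) hpt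
      (Eventually.of_forall fun T => hbound T)
  have hle : ∀ T, ∑' G, (D G).toReal * f T G - ∑' G, (D G).toReal * g T G ≤
      ∑' G, (D G).toReal * max (f T G - g T G) 0 := by
    intro T
    rw [← (hsum hf T).tsum_sub (hsum hg T)]
    refine Summable.tsum_le_tsum (fun G => ?_) ((hsum hf T).sub (hsum hg T))
      (Summable.of_norm_bounded (hB.mul_left 2) (hbound T))
    rw [← mul_sub]
    exact mul_le_mul_of_nonneg_left (le_max_left _ _) ENNReal.toReal_nonneg
  have hE : Tendsto (fun T => ((∑' G, (D G).toReal * max (f T G - g T G) 0 : ℝ) : EReal)) atTop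
      (𝓝 ((0 : ℝ) : EReal)) := (continuous_coe_real_ereal.tendsto 0).comp hlim
  refine (limsup_le_limsup (Eventually.of_forall fun T => EReal.coe_le_coe_iff.2 (hle T))).trans ?_
  rw [hE.limsup_eq, EReal.coe_zero]

/-- The learner ignores her signal, so the law of play does not depend on it. -/
theorem trajectoryLaw_learner_signal [Nonempty A₂] (π₁ : Algorithm fb I A₁ A₂) (G : Game A₁ A₂)
    (s₁ s₂ s₂' : I) (T : ℕ) :
    trajectoryLaw π₁ (learner fb I A₂ A₁) G s₁ s₂ T =
      trajectoryLaw π₁ (learner fb I A₂ A₁) G s₁ s₂' T := by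
  induction T with
  | zero => rfl
  | succ T ih =>
    rw [trajectoryLaw, trajectoryLaw, ih]
    rfl

variable {𝒢 : Set (Game A₁ A₂)}

theorem gameUtility₁_learner [Nonempty A₂] (D : PMF 𝒢) (p₂ : ℝ) (π₁ : Algorithm fb 𝒢 A₁ A₂)
    (G : 𝒢) (T : ℕ) :
    gameUtility₁ D 1 p₂ π₁ (learner fb 𝒢 A₂ A₁) G T =
      1 / (T : ℝ) * ∫ h, ∑ t, mixedPayoff (G : Game A₁ A₂).U₁ (h t).1 (h t).2
        ∂(trajectoryLaw π₁ (learner fb 𝒢 A₂ A₁) G G G T) := by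
  unfold gameUtility₁
  rw [tsum_signalProb_one D p₂ G fun s₁ s₂ =>
    signalUtility₁ π₁ (learner fb 𝒢 A₂ A₁) G s₁ s₂ T]
  simp only [signalUtility₁_eq, fun s₂ => trajectoryLaw_learner_signal π₁ (G : Game A₁ A₂) G s₂ G T]
  exact tsum_signalProb_mul_const D p₂ G _

theorem gameUtility₂_learner [Nonempty A₂] (D : PMF 𝒢) (p₂ : ℝ) (π₁ : Algorithm fb 𝒢 A₁ A₂)
    (G : 𝒢) (T : ℕ) :
    gameUtility₂ D 1 p₂ π₁ (learner fb 𝒢 A₂ A₁) G T =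
      1 / (T : ℝ) * ∫ h, ∑ t, mixedPayoff (G : Game A₁ A₂).U₂ (h t).1 (h t).2
        ∂(trajectoryLaw π₁ (learner fb 𝒢 A₂ A₁) G G G T) := by
  unfold gameUtility₂
  rw [tsum_signalProb_one D p₂ G fun s₁ s₂ =>
    signalUtility₂ π₁ (learner fb 𝒢 A₂ A₁) G s₁ s₂ T]
  simp only [signalUtility₂_eq, fun s₂ => trajectoryLaw_learner_signal π₁ (G : Game A₁ A₂) G s₂ G T]
  exact tsum_signalProb_mul_const D p₂ G _

theorem abs_gameUtility₂_le (D : PMF 𝒢) {p₂ : ℝ} (hp₂ : 0 ≤ p₂) (hp₂' : p₂ ≤ 1)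
    (π₁ : Algorithm fb 𝒢 A₁ A₂) (π₂ : Algorithm fb 𝒢 A₂ A₁) (G : 𝒢) (T : ℕ) :
    |gameUtility₂ D 1 p₂ π₁ π₂ G T| ≤ payoffBound (G : Game A₁ A₂).U₂ := by
  unfold gameUtility₂
  rw [tsum_signalProb_one D p₂ G fun s₁ s₂ => signalUtility₂ π₁ π₂ G s₁ s₂ T]
  simp only [signalUtility₂_eq]
  exact abs_tsum_signalProb_mul_le D hp₂ hp₂' G fun s => abs_average_le π₁ π₂ G G s T _

/-- Whatever the second player does and whatever her signal is, she gets at most the best response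
payoffs along the path of a committed first player. -/
theorem gameUtility₂_commitAlgorithm_le (D : PMF 𝒢) {p₂ : ℝ} (hp₂ : 0 ≤ p₂) (hp₂' : p₂ ≤ 1)
    (x : 𝒢 → ℕ → Mixed A₁) (π₂ : Algorithm fb 𝒢 A₂ A₁) (G : 𝒢) {c : ℕ → ℝ}
    (hc : ∀ t y, mixedPayoff (G : Game A₁ A₂).U₂ (x G t) y ≤ c t) (T : ℕ) :
    gameUtility₂ D 1 p₂ (commitAlgorithm fb x) π₂ G T ≤
      1 / (T : ℝ) * ∑ t ∈ Finset.range T, c t := by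
  unfold gameUtility₂
  rw [tsum_signalProb_one D p₂ G fun s₁ s₂ =>
    signalUtility₂ (commitAlgorithm fb x) π₂ G s₁ s₂ T]
  simp only [signalUtility₂_eq]
  exact tsum_signalProb_mul_le D hp₂ hp₂' G (fun s => abs_average_le _ π₂ G G s T _) fun s =>
    mul_le_mul_of_nonneg_left (integral_commitAlgorithm_le x π₂ G G s _ hc T) (by positivity)

theorem summable_mul_payoffBound {ι : Type*} (D : PMF ι) (V : ι → A₁ → A₂ → ℝ)
    (h : ∀ a b, Summable fun G => (D G).toReal * |V G a b|) :
    Summable fun G => (D G).toReal * payoffBound (V G) := by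
  simp only [payoffBound, Finset.mul_sum]
  exact summable_sum fun a _ => summable_sum fun b _ => h a b

end Prior

end RepeatedBayesianGame

end

/-! ### The equilibrium -/

open RepeatedBayesianGame in
theorem theorem1 {A₁ A₂ : Type*} [Fintype A₁] [Fintype A₂] [Nonempty A₁] [Nonempty A₂]
    (fb : Feedback) (𝒢 : Set (Game A₁ A₂)) (D : PMF 𝒢)
    (hU₁ : ∀ a b, Summable fun G : 𝒢 => (D G).toReal * |(G : Game A₁ A₂).U₁ a b|)
    (hU₂ : ∀ a b, Summable fun G : 𝒢 => (D G).toReal * |(G : Game A₁ A₂).U₂ a b|)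
    (hdom : ∀ G ∈ D.support, (G : Game A₁ A₂).NoWeaklyDominatedAction)
    (p₂ : ℝ) (hp₂ : 0 ≤ p₂) (hp₂' : p₂ ≤ 1) :
    ∃ (π₁ : Algorithm fb 𝒢 A₁ A₂) (π₂ : Algorithm fb 𝒢 A₂ A₁),
      IsPureNashEquilibrium D 1 p₂ π₁ π₂ ∧
      ∀ G : 𝒢, (G : Game A₁ A₂).NoWeaklyDominatedAction →
        (∃ ε : ℕ → ℝ, Tendsto ε atTop (𝓝 0) ∧
          ∀ T : ℕ, (G : Game A₁ A₂).stackVal₁ - ε T ≤ gameUtility₁ D 1 p₂ π₁ π₂ G T) ∧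
        Tendsto (fun T : ℕ => gameUtility₁ D 1 p₂ π₁ π₂ G T) atTop
          (𝓝 (G : Game A₁ A₂).stackVal₁) := by
  have hpath : ∀ G : 𝒢, ∃ x : ℕ → Mixed A₁, (G : Game A₁ A₂).NoWeaklyDominatedAction →
      ∃ x₀ b₀ c, (G : Game A₁ A₂).IsStackelbergPath x x₀ b₀ c := by
    intro G
    by_cases hG : (G : Game A₁ A₂).NoWeaklyDominatedAction
    · obtain ⟨x, hx⟩ := hG.exists_isStackelbergPath
      exact ⟨x, fun _ => hx⟩
    · exact ⟨fun _ => pureStrategy (Classical.arbitrary A₁), fun h => absurd h hG⟩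
  choose x hx using hpath
  have hval : ∀ G : 𝒢, (G : Game A₁ A₂).NoWeaklyDominatedAction →
      Tendsto (fun T : ℕ => gameUtility₁ D 1 p₂ (commitAlgorithm fb x) (learner fb 𝒢 A₂ A₁) G T)
        atTop (𝓝 (G : Game A₁ A₂).stackVal₁) := by
    intro G hG
    obtain ⟨x₀, b₀, c, h⟩ := hx G hG
    simp only [gameUtility₁_learner]
    rw [← h.eq_stackVal₁]
    exact tendsto_average_commitAlgorithm x (G : Game A₁ A₂) G G h.pos h.gap h.tendsto _
  refine ⟨commitAlgorithm fb x, learner fb 𝒢 A₂ A₁, ⟨fun π₁' => ?_, fun π₂' => ?_⟩,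
    fun G hG => ⟨⟨fun T => (G : Game A₁ A₂).stackVal₁ -
      gameUtility₁ D 1 p₂ (commitAlgorithm fb x) (learner fb 𝒢 A₂ A₁) G T, ?_, fun T => ?_⟩,
      hval G hG⟩⟩
  · refine limsup_tsum_sub_tsum_le D (summable_mul_payoffBound D _ hU₁) (fun T G => ?_)
      (fun T G => ?_) fun G hG η hη => ?_
    · rw [gameUtility₁_learner]; exact abs_average_le _ _ _ _ _ _ _
    · rw [gameUtility₁_learner]; exact abs_average_le _ _ _ _ _ _ _
    · filter_upwards [eventually_average_le_stackVal₁ π₁' (G : Game A₁ A₂) G G (half_pos hη),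
        (hval G (hdom G hG)).eventually_const_lt (sub_lt_self _ (half_pos hη))] with T h1 h2
      rw [gameUtility₁_learner D p₂ π₁']
      linarith
  · refine limsup_tsum_sub_tsum_le D (summable_mul_payoffBound D _ hU₂)
      (fun T G => abs_gameUtility₂_le D hp₂ hp₂' _ _ G T)
      (fun T G => abs_gameUtility₂_le D hp₂ hp₂' _ _ G T) fun G hG η hη => ?_
    obtain ⟨x₀, b₀, c, h⟩ := hx G (hdom G hG)
    have h1 := tendsto_inv_mul_sum_range (tendsto_finsetSum Finset.univ fun a _ =>
      (h.tendsto a).mul_const ((G : Game A₁ A₂).U₂ a b₀))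
    have h2 := tendsto_average_commitAlgorithm (fb := fb) x (G : Game A₁ A₂) G G h.pos h.gap
      h.tendsto (G : Game A₁ A₂).U₂
    have h3 := h1.sub h2
    rw [sub_self] at h3
    filter_upwards [h3.eventually_lt_const hη] with T hT
    have := gameUtility₂_commitAlgorithm_le D hp₂ hp₂' x π₂' G h.mixedPayoff_le T
    rw [gameUtility₂_learner]
    linarith
  · simpa using (hval G hG).const_sub (G : Game A₁ A₂).stackVal₁
  · simp
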